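/- Let $\lambda_s,\mu_s,\sigma_s,\mu_v,\beta_v,\gamma_v,\sigma_v,\rho_{sv},S_0,V_0$ be real constants with $\lambda_s\neq 0$. Let $W_s,W_v$ be standard Brownian motions on a common probability space such that $(W_s,W_v)$ has independent, jointly Gaussian increments with $\operatorname{Cov}(W_{s,t}-W_{s,r},\,W_{v,t}-W_{v,r})=\rho_{sv}(t-r)$ for $0\le r\le t$. Let $(S_t,V_t)_{t\ge 0}$ be a continuous solution, started at the deterministic point $(S_0,V_0)$, of $$dS_t=\lambda_s(\mu_s-S_t)\,dt+\sigma_s\,dW_{s,t},\qquad dV_t=\bigl(\mu_v+\beta_v(S_t-\mu_s)^2-\gamma_vV_t\bigr)\,dt+\sigma_v\,dW_{v,t}.$$ Then for every $t\ge 0$ we have $\mathbb E[S_t^4]<\infty$ and $\mathbb E[V_t^2]<\infty$, and \begin{align*} \mathbb E[S_t]&=e^{-\lambda_st}S_0+\mu_s(1-e^{-\lambda_st}),\\ \mathbb E[S_t^2]&=\frac{\sigma_s^2}{2\lambda_s}(1-e^{-2\lambda_st})+(\mathbb E[S_t])^2,\\ \mathbb E[S_t^3]&=\mathbb E[S_t]\bigl((\mathbb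 E[S_t])^2+3(\mathbb E[S_t^2]-(\mathbb E[S_t])^2)\bigr),\\ \mathbb E[S_t^4]&=(\mathbb E[S_t])^4+6(\mathbb E[S_t])^2\bigl(\mathbb E[S_t^2]-(\mathbb E[S_t])^2\bigr)+3\bigl(\mathbb E[S_t^2]-(\mathbb E[S_t])^2\bigr)^2,\\ \mathbb E[V_t]&=e^{-\gamma_vt}V_0+\int_0^te^{\gamma_v(u-t)}\bigl[\mu_v+\beta_v(\mathbb E[S_u^2]-2\mu_s\mathbb E[S_u]+\mu_s^2)\bigr]du,\\ \mathbb E[S_tV_t]&=e^{-(\gamma_v+\lambda_s)t}S_0V_0+\int_0^te^{(\gamma_v+\lambda_s)(u-t)}\Bigl(\lambda_s\mu_s\mathbb E[V_u]+\sigma_s\sigma_v\rho_{sv}+(\mu_v+\beta_v\mu_s^2)\mathbb E[S_u]-2\beta_v\mu_s\mathbb E[S_u^2]+\beta_v\mathbb E[S_u^3]\Bigr)du,\\ \mathbb E[S_t^2V_t]&=e^{-(\gamma_v+2\lambda_s)t}S_0^2V_0+\int_0^te^{(\gamma_v+2\lambda_s)(u-t)}\Bigl(2\sigma_v\sigma_s\rho_{sv}\mathbb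 E[S_u]+(\mu_v+\beta_v\mu_s^2)\mathbb E[S_u^2]-2\mu_s\beta_v\mathbb E[S_u^3]+\beta_v\mathbb E[S_u^4]\\ &\qquad\qquad+2\lambda_s\mu_s\mathbb E[S_uV_u]+\sigma_s^2\mathbb E[V_u]\Bigr)du,\\ \mathbb E[V_t^2]&=e^{-2\gamma_vt}V_0^2+\int_0^te^{2\gamma_v(u-t)}\Bigl(2(\mu_v+\beta_v\mu_s^2)\mathbb E[V_u]-4\beta_v\mu_s\mathbb E[S_uV_u]+2\beta_v\mathbb E[S_u^2V_u]+\sigma_v^2\Bigr)du. \end{align*} Substituted successively into one another, these formulas express each moment as an explicit function of $t$ and the constants. Moreover, if $t>0$, $\sigma_s\ne0$ and $(\sigma_v,\beta_v)\neq(0,0)$, then $S_t$ and $V_t$ have positive variances, so that their correlation coefficient $\rho(S_t,V_t)=\operatorname{Cov}(S_t,V_t)/\bigl(\sqrt{\operatorname{Var}S_t}\sqrt{\operatorname{Var}V_t}\bigr)$ is defined, and $$\rho(S_t,V_t)=\frac{\mathbb E[S_tV_t]-\mathbb E[S_t]\,\mathbb E[V_t]}{\sqrt{\mathbb E[S_t^2]-(\mathbb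 E[S_t])^2}\,\sqrt{\mathbb E[V_t^2]-(\mathbb E[V_t])^2}},$$ where all the expectations are given by the formulas above. -/

import Mathlib

open MeasureTheory ProbabilityTheory
open scoped NNReal

noncomputable section

/-- Two standard Brownian motions on a common probability space with instantaneous correlation `ρ`:
jointly they form a planar process with independent increments, and the increment over `[s, t]` is
a centred bivariate Gaussian vector with covariance matrix `(t - s) • !![1, ρ; ρ, 1]`. -/
structure IsCorrelatedBrownianPair {Ω : Type*} [MeasurableSpace Ω]
    (W₁ W₂ : ℝ≥0 → Ω → ℝ) (ρ : ℝ) (P : Measure Ω) : Prop where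
  fst : IsBrownianReal W₁ P
  snd : IsBrownianReal W₂ P
  indep : HasIndepIncrements (fun t ω => (W₁ t ω, W₂ t ω)) P
  gaussian : ∀ s t : ℝ≥0, s ≤ t →
    HasGaussianLaw (fun ω => (W₁ t ω - W₁ s ω, W₂ t ω - W₂ s ω)) P
  cov_increments : ∀ s t : ℝ≥0, s ≤ t →
    cov[fun ω => W₁ t ω - W₁ s ω, fun ω => W₂ t ω - W₂ s ω; P] = ρ * ((t : ℝ) - s)

/-- The parameters and the (deterministic) initial values of the sentiment / volatility model. -/
structure SSVParams where
  /-- speed of mean reversion of the sentiment -/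
  lamS : ℝ
  /-- long-run mean of the sentiment -/
  muS : ℝ
  /-- diffusion parameter of the sentiment -/
  sigS : ℝ
  /-- constant part of the drift of the volatility -/
  muV : ℝ
  /-- loading of the volatility on the squared centred sentiment -/
  betaV : ℝ
  /-- speed of mean reversion of the volatility -/
  gamV : ℝ
  /-- diffusion parameter of the volatility -/
  sigV : ℝ
  /-- instantaneous correlation of the two driving Brownian motions -/
  rhoSV : ℝ
  /-- initial sentiment -/
  S0 : ℝ
  /-- initial volatility -/
  V0 : ℝ

/-- `(S, V)` solves, with driving noises `Ws`, `Wv`,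
`dS = lamS (muS - S) dt + sigS dWs` and
`dV = (muV + betaV (S - muS)^2 - gamV V) dt + sigV dWv`, started at `(S0, V0)`.
The noise is additive, so `∫₀ᵗ sigS dWs = sigS * Ws t` (and likewise for `V`), and the equations are
integral equations that hold pathwise. -/
structure IsSSVSolution {Ω : Type*} [MeasurableSpace Ω] (p : SSVParams)
    (Ws Wv S V : ℝ≥0 → Ω → ℝ) (P : Measure Ω) : Prop where
  noise : IsCorrelatedBrownianPair Ws Wv p.rhoSV P
  aemeasurable_S : ∀ t, AEMeasurable (S t) P
  aemeasurable_V : ∀ t, AEMeasurable (V t) P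
  continuous_S : ∀ᵐ ω ∂P, Continuous fun t => S t ω
  continuous_V : ∀ᵐ ω ∂P, Continuous fun t => V t ω
  eq_S : ∀ᵐ ω ∂P, ∀ t : ℝ≥0,
    S t ω = p.S0 + (∫ u in (0 : ℝ)..t, p.lamS * (p.muS - S u.toNNReal ω)) + p.sigS * Ws t ω
  eq_V : ∀ᵐ ω ∂P, ∀ t : ℝ≥0,
    V t ω = p.V0
      + (∫ u in (0 : ℝ)..t,
          (p.muV + p.betaV * (S u.toNNReal ω - p.muS) ^ 2 - p.gamV * V u.toNNReal ω))
      + p.sigV * Wv t ω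

/-- The Pearson correlation coefficient of two real random variables. -/
def correlation {Ω : Type*} [MeasurableSpace Ω] (X Y : Ω → ℝ) (P : Measure Ω) : ℝ :=
  cov[X, Y; P] / (√(Var[X; P]) * √(Var[Y; P]))

namespace SSVParams

/-! Explicit deterministic functions of the parameters and of time: the values of the moments. -/

/-- value of `E[S_t]` -/
def mS (p : SSVParams) (t : ℝ) : ℝ :=
  Real.exp (-p.lamS * t) * p.S0 + p.muS * (1 - Real.exp (-p.lamS * t))

/-- value of `E[S_t ^ 2]` -/
def mS2 (p : SSVParams) (t : ℝ) : ℝ :=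
  p.sigS ^ 2 / (2 * p.lamS) * (1 - Real.exp (-2 * p.lamS * t)) + p.mS t ^ 2

/-- value of `E[S_t ^ 3]` -/
def mS3 (p : SSVParams) (t : ℝ) : ℝ :=
  p.mS t * (p.mS t ^ 2 + 3 * (p.mS2 t - p.mS t ^ 2))

/-- value of `E[S_t ^ 4]` -/
def mS4 (p : SSVParams) (t : ℝ) : ℝ :=
  p.mS t ^ 4 + 6 * p.mS t ^ 2 * (p.mS2 t - p.mS t ^ 2) + 3 * (p.mS2 t - p.mS t ^ 2) ^ 2

/-- value of `E[V_t]` -/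
def mV (p : SSVParams) (t : ℝ) : ℝ :=
  Real.exp (-p.gamV * t) * p.V0
    + ∫ u in (0 : ℝ)..t, Real.exp (p.gamV * (u - t)) *
        (p.muV + p.betaV * (p.mS2 u - 2 * p.muS * p.mS u + p.muS ^ 2))

/-- value of `E[S_t V_t]` -/
def mSV (p : SSVParams) (t : ℝ) : ℝ :=
  Real.exp (-(p.gamV + p.lamS) * t) * (p.S0 * p.V0)
    + ∫ u in (0 : ℝ)..t, Real.exp ((p.gamV + p.lamS) * (u - t)) *
        (p.lamS * p.muS * p.mV u + p.sigS * p.sigV * p.rhoSV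
          + (p.muV + p.betaV * p.muS ^ 2) * p.mS u
          - 2 * (p.betaV * p.muS) * p.mS2 u
          + p.betaV * p.mS3 u)

/-- value of `E[S_t ^ 2 V_t]` -/
def mS2V (p : SSVParams) (t : ℝ) : ℝ :=
  Real.exp (-(p.gamV + 2 * p.lamS) * t) * (p.S0 ^ 2 * p.V0)
    + ∫ u in (0 : ℝ)..t, Real.exp ((p.gamV + 2 * p.lamS) * (u - t)) *
        (2 * p.sigV * p.sigS * p.rhoSV * p.mS u
          + (p.muV + p.betaV * p.muS ^ 2) * p.mS2 u
          - 2 * p.muS * p.betaV * p.mS3 u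
          + p.betaV * p.mS4 u
          + 2 * p.lamS * p.muS * p.mSV u
          + p.sigS ^ 2 * p.mV u)

/-- value of `E[V_t ^ 2]` -/
def mV2 (p : SSVParams) (t : ℝ) : ℝ :=
  Real.exp (-2 * p.gamV * t) * p.V0 ^ 2
    + ∫ u in (0 : ℝ)..t, Real.exp (2 * p.gamV * (u - t)) *
        (2 * (p.muV + p.betaV * p.muS ^ 2) * p.mV u
          - 4 * p.betaV * p.muS * p.mSV u
          + 2 * p.betaV * p.mS2V u
          + p.sigV ^ 2)

end SSVParams

end

noncomputable section

/-! ### Riemann sums and variation of constants -/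

section Analysis

open Filter Topology

variable {E : Type*} [NormedAddCommGroup E] [NormedSpace ℝ E]

/-! The noise is additive, so Itô calculus is not needed: path by path the equations are linear
integral equations, solved by variation of constants (`eq_of_linear_integral_equation`) with
ordinary integrals of the Brownian paths. This gives S = `mS` + Z with Z a centred
Ornstein–Uhlenbeck process, and V = D + Y, where Y is the Ornstein–Uhlenbeck process driven by `Wv`
and D solves D' = -`gamV` D + q, with q a combination of 1, Z and Z² having deterministic
coefficients.

All of these are read as curves in the Hilbert space L²(P). Pathwise integrals agree with L²
integrals (`intervalIntegral_ae_eq_Lp`), so expectations of products are inner products and pass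
through integrals in time. The Brownian variables span a space of centred Gaussians; its closure is
still Gaussian (`IsGaussianSubspace.topologicalClosure`) and contains Z and Y. Moments of S are
therefore those of a shifted Gaussian, while E[V], E[ZV] and E[Z²V] are the inner products of V with
1, Z and Z². They follow from the covariances of Z and Y (`inner_ouCurve_ouCurve`) and the Isserlis
formulas (`inner_sqLp_left`, `inner_sqLp_sqLp`).

The nested integrals of the statement are recovered from these central moments by uniqueness for
linear equations (`eq_variationOfConstants`): see `mSV_eq`, `mS2V_eq` and, for E[V²],
`inner_vol_vol`. The variance of V is positive because a constant V would be uncorrelated with both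
Y and Z², and at least one of these covariances is nonzero. -/

lemma integral_exp_mul_sub_smul (a : ℝ) (f : ℝ → E) (t : ℝ) :
    ∫ u in (0 : ℝ)..t, Real.exp (a * (u - t)) • f u
      = Real.exp (-a * t) • ∫ u in (0 : ℝ)..t, Real.exp (a * u) • f u := by
  rw [← intervalIntegral.integral_smul]
  congr 1
  ext u
  rw [smul_smul, ← Real.exp_add]
  congr 2
  ring

variable [CompleteSpace E]

/-- Left Riemann sums of a continuous function converge to its integral. -/
lemma tendsto_riemannSum_intervalIntegral {F : ℝ → E} (hF : Continuous F) {t : ℝ} (ht : 0 ≤ t) :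
    Tendsto (fun n : ℕ => ∑ k ∈ Finset.range n, (t / n) • F (k * (t / n))) atTop
      (𝓝 (∫ u in (0 : ℝ)..t, F u)) := by
  rw [Metric.tendsto_atTop]
  intro ε hε
  have hu : UniformContinuousOn F (Set.Icc 0 t) :=
    isCompact_Icc.uniformContinuousOn_of_continuous hF.continuousOn
  -- Dividing by `t + 1` rather than `t` admits `t = 0`; the total error is at most ε t / (t + 1) <
  -- ε.
  obtain ⟨δ, hδ, hFδ⟩ := Metric.uniformContinuousOn_iff.1 hu (ε / (t + 1)) (by positivity)
  obtain ⟨N, hN⟩ := exists_nat_gt (t / δ)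
  refine ⟨N + 1, fun n hn => ?_⟩
  have hn0 : (0 : ℝ) < n := by exact_mod_cast (by omega : 0 < n)
  have hh : t / n < δ := by
    rw [div_lt_iff₀ hn0]
    rw [div_lt_iff₀ hδ] at hN
    have : (N : ℝ) < n := by exact_mod_cast hn
    nlinarith
  set h : ℝ := t / n with hh_def
  have h0 : 0 ≤ h := by positivity
  have hnh : n * h = t := by rw [hh_def]; field_simp
  have hint : ∀ a b : ℝ, IntervalIntegrable F volume a b := fun a b => hF.intervalIntegrable a b
  have hsum : ∫ u in (0 : ℝ)..t, F u
      = ∑ k ∈ Finset.range n, ∫ u in (k * h)..((k + 1 : ℕ) * h), F u := by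
    rw [intervalIntegral.sum_integral_adjacent_intervals (a := fun k : ℕ => (k : ℝ) * h)
      (fun k _ => hint _ _)]
    simp [hnh]
  rw [dist_comm, dist_eq_norm, hsum, ← Finset.sum_sub_distrib]
  have hterm : ∀ k ∈ Finset.range n,
      ‖(∫ u in (k * h)..((k + 1 : ℕ) * h), F u) - h • F (k * h)‖ ≤ ε / (t + 1) * h := by
    intro k hk
    have hk' : ((k : ℝ) + 1) ≤ n := by exact_mod_cast Finset.mem_range.1 hk
    have hlen : ((k + 1 : ℕ) : ℝ) * h - k * h = h := by push_cast; ring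
    have hle : (k : ℝ) * h ≤ ((k + 1 : ℕ) : ℝ) * h := by linarith
    have hconst : h • F (k * h) = ∫ _u in ((k : ℝ) * h)..((k + 1 : ℕ) * h), F (k * h) := by
      rw [intervalIntegral.integral_const, hlen]
    rw [hconst, ← intervalIntegral.integral_sub (hint _ _) (by simp)]
    refine (intervalIntegral.norm_integral_le_of_norm_le_const fun u hu => ?_).trans_eq
      (by rw [hlen, abs_of_nonneg h0])
    rw [Set.uIoc_of_le hle] at hu
    have hkh : 0 ≤ (k : ℝ) * h := by positivity
    have hub : ((k + 1 : ℕ) : ℝ) * h ≤ t := by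
      rw [← hnh]; push_cast; exact mul_le_mul_of_nonneg_right hk' h0
    have := hFδ u ⟨hkh.trans hu.1.le, hu.2.trans hub⟩ (k * h) ⟨hkh, hle.trans hub⟩ (by
      rw [Real.dist_eq, abs_of_nonneg (by linarith [hu.1])]
      linarith [hu.2])
    rw [dist_eq_norm] at this
    exact this.le
  refine (norm_sum_le_of_le _ hterm).trans_lt ?_
  rw [Finset.sum_const, Finset.card_range, nsmul_eq_mul]
  have : (n : ℝ) * (ε / (t + 1) * h) = ε * (t / (t + 1)) := by
    rw [← hnh]; ring
  rw [this]
  have : t / (t + 1) < 1 := by rw [div_lt_one (by positivity)]; linarith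
  nlinarith

/-- Pulling out exp(-a t) leaves an integrand free of the upper limit, so the product rule and the
fundamental theorem suffice. -/
lemma hasDerivAt_expConvolution (a : ℝ) {f : ℝ → E} (hf : Continuous f) (t : ℝ) :
    HasDerivAt (fun t => ∫ u in (0 : ℝ)..t, Real.exp (a * (u - t)) • f u)
      (-(a • ∫ u in (0 : ℝ)..t, Real.exp (a * (u - t)) • f u) + f t) t := by
  have hexp : HasDerivAt (fun t : ℝ => Real.exp (-a * t)) (Real.exp (-a * t) * (-a)) t := by
    simpa using ((hasDerivAt_id t).const_mul (-a)).exp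
  have hc : Continuous fun u => Real.exp (a * u) • f u := by fun_prop
  have hint := intervalIntegral.integral_hasDerivAt_right (hc.intervalIntegrable 0 t)
    (hc.stronglyMeasurableAtFilter _ _) hc.continuousAt
  simp_rw [integral_exp_mul_sub_smul]
  refine (hexp.smul hint).congr_deriv ?_
  rw [smul_smul (Real.exp (-a * t)), ← Real.exp_add, smul_smul, add_comm]
  congr 1
  · module
  · simp

lemma hasDerivAt_variationOfConstants (a : ℝ) (x₀ : E) {f : ℝ → E} (hf : Continuous f) (t : ℝ) :
    HasDerivAt
      (fun t => Real.exp (-a * t) • x₀ + ∫ u in (0 : ℝ)..t, Real.exp (a * (u - t)) • f u)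
      (-(a • (Real.exp (-a * t) • x₀ + ∫ u in (0 : ℝ)..t, Real.exp (a * (u - t)) • f u)) + f t)
      t := by
  have hexp : HasDerivAt (fun t : ℝ => Real.exp (-a * t)) (Real.exp (-a * t) * (-a)) t := by
    simpa using ((hasDerivAt_id t).const_mul (-a)).exp
  refine ((hexp.smul_const x₀).add (hasDerivAt_expConvolution a hf t)).congr_deriv ?_
  module

/-- The linear equation `dg = (-a g + f) dt` is solved by the variation of constants formula. -/
lemma eq_variationOfConstants {a : ℝ} {f g : ℝ → E} (hf : Continuous f)
    (hg : ∀ t, HasDerivAt g (-(a • g t) + f t) t) (t : ℝ) :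
    g t = Real.exp (-a * t) • g 0 + ∫ u in (0 : ℝ)..t, Real.exp (a * (u - t)) • f u := by
  have hd : ∀ s, HasDerivAt (fun s => Real.exp (a * s) • g s) (Real.exp (a * s) • f s) s := by
    intro s
    have hexp : HasDerivAt (fun t : ℝ => Real.exp (a * t)) (Real.exp (a * s) * a) s := by
      simpa using ((hasDerivAt_id s).const_mul a).exp
    refine (hexp.smul (hg s)).congr_deriv ?_
    rw [smul_add, smul_neg, smul_smul]
    abel
  have hc : Continuous fun u => Real.exp (a * u) • f u := by fun_prop
  have hftc := intervalIntegral.integral_eq_sub_of_hasDerivAt (fun s _ => hd s)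
    (hc.intervalIntegrable 0 t)
  rw [integral_exp_mul_sub_smul, hftc, smul_sub, smul_smul, ← Real.exp_add]
  simp

/-- A solution of a linear integral equation with additive noise `w`, solved explicitly. -/
lemma eq_of_linear_integral_equation {a x₀ : ℝ} {f x w : ℝ → ℝ} (hf : Continuous f)
    (hx : Continuous x)
    (h : ∀ t, 0 ≤ t → x t = x₀ + (∫ u in (0 : ℝ)..t, (f u - a * x u)) + w t)
    {t : ℝ} (ht : 0 ≤ t) :
    x t = Real.exp (-a * t) * x₀ + (∫ u in (0 : ℝ)..t, Real.exp (a * (u - t)) * f u)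
      + (w t - a * ∫ u in (0 : ℝ)..t, Real.exp (a * (u - t)) * w u) := by
  -- The noise `w` is not differentiable, but y = x - w is, and it satisfies y' = -a y + f - a w.
  set y : ℝ → ℝ := fun t => x₀ + ∫ u in (0 : ℝ)..t, (f u - a * x u) with hy_def
  have hc : Continuous fun u => f u - a * x u := by fun_prop
  have hy : ∀ t, HasDerivAt y (f t - a * x t) t := fun t =>
    (intervalIntegral.integral_hasDerivAt_right (hc.intervalIntegrable 0 t)
      (hc.stronglyMeasurableAtFilter _ _) hc.continuousAt).const_add x₀
  have hyc : Continuous y := continuous_iff_continuousAt.2 fun t => (hy t).continuousAt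
  -- The integral equation holds only for nonnegative times, so the source is written with `x u - y
  -- u`, continuous on all of ℝ, and replaced by `w u` only on [0, t].
  have hsol := eq_variationOfConstants (a := a) (f := fun u => f u - a * (x u - y u)) (g := y)
    (by fun_prop) (fun t => (hy t).congr_deriv (by simp only [smul_eq_mul]; ring)) t
  have hw : ∀ u ∈ Set.uIcc 0 t, x u - y u = w u := by
    intro u hu
    rw [Set.uIcc_of_le ht] at hu
    rw [h u hu.1]; simp [hy_def]
  have hint : ∫ u in (0 : ℝ)..t, Real.exp (a * (u - t)) • (f u - a * (x u - y u))
      = (∫ u in (0 : ℝ)..t, Real.exp (a * (u - t)) * f u)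
        - a * ∫ u in (0 : ℝ)..t, Real.exp (a * (u - t)) * w u := by
    rw [← intervalIntegral.integral_congr (f := fun u => Real.exp (a * (u - t)) * (x u - y u))
      (g := fun u => Real.exp (a * (u - t)) * w u) fun u hu => by simp [hw u hu]]
    rw [← intervalIntegral.integral_const_mul, ← intervalIntegral.integral_sub]
    · congr 1; ext u; simp only [smul_eq_mul]; ring
    · exact Continuous.intervalIntegrable (by fun_prop) _ _
    · exact Continuous.intervalIntegrable (by fun_prop) _ _
  have hxy : x t = y t + w t := h t ht
  have hy0 : y 0 = x₀ := by simp [hy_def]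
  rw [hxy, hsol, hint, hy0, smul_eq_mul]
  ring

end Analysis

/-! ### Ornstein–Uhlenbeck curves in a Hilbert space -/

section OrnsteinUhlenbeck

open scoped InnerProductSpace

variable {H : Type*} [NormedAddCommGroup H] [InnerProductSpace ℝ H] [CompleteSpace H]

/-- The solution of `dZ = -a Z dt + dB`, `Z 0 = B 0`, driven by a continuous curve `B`. -/
def ouCurve (a : ℝ) (B : ℝ → H) (t : ℝ) : H :=
  B t - a • ∫ u in (0 : ℝ)..t, Real.exp (a * (u - t)) • B u

lemma continuous_ouCurve (a : ℝ) {B : ℝ → H} (hB : Continuous B) : Continuous (ouCurve a B) := by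
  refine hB.sub (Continuous.const_smul ?_ a)
  exact continuous_iff_continuousAt.2 fun t => (hasDerivAt_expConvolution a hB t).continuousAt

lemma inner_intervalIntegral_right {F : ℝ → H} (hF : Continuous F) (x : H) (s t : ℝ) :
    ⟪x, ∫ u in s..t, F u⟫_ℝ = ∫ u in s..t, ⟪x, F u⟫_ℝ :=
  ((innerSL ℝ x).intervalIntegral_comp_comm (hF.intervalIntegrable s t)).symm

lemma inner_intervalIntegral_left {F : ℝ → H} (hF : Continuous F) (x : H) (s t : ℝ) :
    ⟪∫ u in s..t, F u, x⟫_ℝ = ∫ u in s..t, ⟪F u, x⟫_ℝ := by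
  simp_rw [real_inner_comm x]
  exact inner_intervalIntegral_right hF x s t

/-- A closed subspace is its own double orthogonal complement, and the integral of a curve in `K` is
orthogonal to whatever is orthogonal to `K`. -/
lemma ouCurve_mem {K : Submodule ℝ H} (hK : IsClosed (K : Set H)) (a : ℝ) {B : ℝ → H}
    (hB : Continuous B) (hBK : ∀ t, B t ∈ K) (t : ℝ) : ouCurve a B t ∈ K := by
  refine K.sub_mem (hBK t) (K.smul_mem _ ?_)
  have : CompleteSpace K := hK.completeSpace_coe
  rw [← K.orthogonal_orthogonal, Submodule.mem_orthogonal]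
  intro y hy
  rw [inner_intervalIntegral_right (by fun_prop)]
  simp_rw [inner_smul_right, (Submodule.mem_orthogonal' K y).1 hy _ (hBK _)]
  simp

/-- The constant 1 solves g' = -a g + a; keeping the factor `a` on the left covers a = 0. -/
lemma integral_exp_mul_eq (a t : ℝ) :
    a * ∫ u in (0 : ℝ)..t, Real.exp (a * (u - t)) = 1 - Real.exp (-a * t) := by
  have := eq_variationOfConstants (a := a) (f := fun _ => a) (g := fun _ => (1 : ℝ))
    continuous_const (fun t => by simpa using hasDerivAt_const t (1 : ℝ)) t
  simp only [smul_eq_mul, intervalIntegral.integral_mul_const] at this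
  linarith

variable {B C : ℝ → H} {c : ℝ}

/-- Covariance of a Brownian curve with an Ornstein–Uhlenbeck curve at a later time. -/
lemma inner_brownian_ouCurve (hC : Continuous C)
    (h : ∀ s t, 0 ≤ s → 0 ≤ t → ⟪B s, C t⟫_ℝ = c * min s t) (b : ℝ) {s t : ℝ} (hs : 0 ≤ s)
    (hst : s ≤ t) :
    ⟪B s, ouCurve b C t⟫_ℝ = c * (Real.exp (-b * t) * ∫ u in (0 : ℝ)..s, Real.exp (b * u)) := by
  -- The kernel `min s u` is split at u = s. Below, `h1` is the fundamental theorem and `h2`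
  -- integration by parts; both avoid dividing by `b`, which may be 0.
  have ht := hs.trans hst
  have hint : ∫ u in (0 : ℝ)..t, Real.exp (b * u) * min s u
      = (∫ u in (0 : ℝ)..s, Real.exp (b * u) * u) + s * ∫ u in s..t, Real.exp (b * u) := by
    have hc : Continuous fun u => Real.exp (b * u) * min s u := by fun_prop
    rw [← intervalIntegral.integral_add_adjacent_intervals (hc.intervalIntegrable 0 s)
      (hc.intervalIntegrable s t), ← intervalIntegral.integral_const_mul]
    congr 1
    · refine intervalIntegral.integral_congr fun u hu => ?_
      rw [Set.uIcc_of_le hs] at hu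
      simp [min_eq_right hu.2]
    · refine intervalIntegral.integral_congr fun u hu => ?_
      rw [Set.uIcc_of_le hst] at hu
      simp [min_eq_left hu.1, mul_comm]
  have hexp : ∀ u, HasDerivAt (fun u => Real.exp (b * u)) (b * Real.exp (b * u)) u := by
    intro u
    simpa [mul_comm] using ((hasDerivAt_id u).const_mul b).exp
  have h1 : b * ∫ u in s..t, Real.exp (b * u) = Real.exp (b * t) - Real.exp (b * s) := by
    rw [← intervalIntegral.integral_const_mul]
    exact intervalIntegral.integral_eq_sub_of_hasDerivAt (fun u _ => hexp u)
      (Continuous.intervalIntegrable (by fun_prop) _ _)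
  have h2 : b * (∫ u in (0 : ℝ)..s, Real.exp (b * u) * u) + ∫ u in (0 : ℝ)..s, Real.exp (b * u)
      = Real.exp (b * s) * s := by
    rw [← intervalIntegral.integral_const_mul, ← intervalIntegral.integral_add
      (Continuous.intervalIntegrable (by fun_prop) _ _)
      (Continuous.intervalIntegrable (by fun_prop) _ _)]
    rw [intervalIntegral.integral_eq_sub_of_hasDerivAt (f := fun u => Real.exp (b * u) * u)
      (fun u _ => by
        refine ((hexp u).mul (hasDerivAt_id u)).congr_deriv ?_
        simp only [id]; ring)
      (Continuous.intervalIntegrable (by fun_prop) _ _)]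
    simp
  have hcov : ∫ u in (0 : ℝ)..t, Real.exp (b * u) * ⟪B s, C u⟫_ℝ
      = c * ∫ u in (0 : ℝ)..t, Real.exp (b * u) * min s u := by
    rw [← intervalIntegral.integral_const_mul]
    refine intervalIntegral.integral_congr fun u hu => ?_
    rw [Set.uIcc_of_le ht] at hu
    simp only [h s u hs hu.1]; ring
  have hE : Real.exp (-b * t) * Real.exp (b * t) = 1 := by rw [← Real.exp_add]; simp
  rw [ouCurve, inner_sub_right, inner_smul_right, integral_exp_mul_sub_smul, inner_smul_right,
    inner_intervalIntegral_right (by fun_prop)]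
  simp_rw [inner_smul_right]
  rw [hcov, hint, h s t hs ht, min_eq_left hst]
  linear_combination (-c * s * Real.exp (-b * t)) * h1 + (-c * Real.exp (-b * t)) * h2
    - c * s * hE

/-- Covariance of two Ornstein–Uhlenbeck curves driven by correlated Brownian curves. -/
lemma inner_ouCurve_ouCurve (hB : Continuous B) (hC : Continuous C)
    (h : ∀ s t, 0 ≤ s → 0 ≤ t → ⟪B s, C t⟫_ℝ = c * min s t) (a b : ℝ) {s t : ℝ} (hs : 0 ≤ s)
    (hst : s ≤ t) :
    ⟪ouCurve a B s, ouCurve b C t⟫_ℝ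
      = Real.exp (b * (s - t)) * (c * ∫ u in (0 : ℝ)..s, Real.exp ((a + b) * (u - s))) := by
  set K : ℝ → ℝ := fun s => ∫ u in (0 : ℝ)..s, Real.exp (b * u) with hK_def
  have hKd : ∀ u, HasDerivAt K (Real.exp (b * u)) u := fun u =>
    intervalIntegral.integral_hasDerivAt_right (Continuous.intervalIntegrable (by fun_prop) _ _)
      (Continuous.stronglyMeasurableAtFilter (by fun_prop) _ _)
      (Continuous.continuousAt (by fun_prop))
  have hKc : Continuous K := continuous_iff_continuousAt.2 fun t => (hKd t).continuousAt
  -- `K` trivially solves K' = -a K + (a K + exp(b u)); variation of constants then acts as an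
  -- integration by parts, turning the weighted integral of `K` into one with exponent a + b.
  have hVOC := eq_variationOfConstants (a := a) (g := K) (f := fun u => a * K u + Real.exp (b * u))
    (by fun_prop) (fun u => (hKd u).congr_deriv (by simp)) s
  simp only [smul_eq_mul, hK_def, intervalIntegral.integral_same, mul_zero, zero_add] at hVOC
  have hsplit : ∫ u in (0 : ℝ)..s, Real.exp (a * (u - s)) * (a * K u + Real.exp (b * u))
      = a * (∫ u in (0 : ℝ)..s, Real.exp (a * (u - s)) * K u)
        + Real.exp (b * s) * ∫ u in (0 : ℝ)..s, Real.exp ((a + b) * (u - s)) := by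
    rw [← intervalIntegral.integral_const_mul, ← intervalIntegral.integral_const_mul,
      ← intervalIntegral.integral_add (Continuous.intervalIntegrable (by fun_prop) _ _)
      (Continuous.intervalIntegrable (by fun_prop) _ _)]
    congr 1
    ext u
    rw [← Real.exp_add, mul_add, ← Real.exp_add]
    congr 1
    · ring
    · congr 1; ring
  have hcov : ∫ u in (0 : ℝ)..s, Real.exp (a * (u - s)) * ⟪B u, ouCurve b C t⟫_ℝ
      = c * Real.exp (-b * t) * ∫ u in (0 : ℝ)..s, Real.exp (a * (u - s)) * K u := by
    rw [← intervalIntegral.integral_const_mul]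
    refine intervalIntegral.integral_congr fun u hu => ?_
    rw [Set.uIcc_of_le hs] at hu
    simp only [inner_brownian_ouCurve hC h b hu.1 (hu.2.trans hst), hK_def]
    ring
  have hE : Real.exp (b * (s - t)) = Real.exp (-b * t) * Real.exp (b * s) := by
    rw [← Real.exp_add]; congr 1; ring
  rw [ouCurve, inner_sub_left, real_inner_smul_left, inner_intervalIntegral_left (by fun_prop)]
  simp_rw [real_inner_smul_left]
  rw [hcov, inner_brownian_ouCurve hC h b hs hst, hE]
  change ∫ u in (0 : ℝ)..s, Real.exp (b * u) = ∫ u in (0 : ℝ)..s,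
    Real.exp (a * (u - s)) * (a * K u + Real.exp (b * u)) at hVOC
  rw [hsplit] at hVOC
  linear_combination (c * Real.exp (-b * t)) * hVOC

end OrnsteinUhlenbeck

/-! ### Gaussian subspaces of `L²` -/

section GaussianSubspace

open Filter Topology
open scoped InnerProductSpace ENNReal

variable {Ω : Type*} [MeasurableSpace Ω] {P : Measure Ω}

lemma inner_Lp_eq_integral_mul (f g : Lp ℝ 2 P) : ⟪f, g⟫_ℝ = ∫ ω, f ω * g ω ∂P := by
  rw [L2.inner_def]
  congr 1
  ext ω
  simp [mul_comm]

lemma integrable_mul_Lp (f g : Lp ℝ 2 P) : Integrable (fun ω => f ω * g ω) P := by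
  refine (L2.integrable_inner (𝕜 := ℝ) f g).congr (ae_of_all _ fun ω => ?_)
  simp [mul_comm]

lemma norm_sq_Lp_eq_integral_sq (f : Lp ℝ 2 P) : ‖f‖ ^ 2 = ∫ ω, f ω ^ 2 ∂P := by
  rw [← real_inner_self_eq_norm_sq, inner_Lp_eq_integral_mul]
  simp [sq]

/-- The pathwise integral of a process with continuous paths is a version of the integral of the
corresponding curve in `L²`, if that curve is continuous. -/
lemma intervalIntegral_ae_eq_Lp [IsFiniteMeasure P] {X : ℝ → Ω → ℝ} {F : ℝ → Lp ℝ 2 P}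
    (hF : Continuous F) (hX : ∀ u, 0 ≤ u → X u =ᵐ[P] F u)
    (hc : ∀ᵐ ω ∂P, Continuous fun u => X u ω) {t : ℝ} (ht : 0 ≤ t) :
    (fun ω => ∫ u in (0 : ℝ)..t, X u ω) =ᵐ[P] (∫ u in (0 : ℝ)..t, F u : Lp ℝ 2 P) := by
  -- The same Riemann sums converge to the L² integral in norm and to the pathwise integral almost
  -- surely. Both imply convergence in measure, whose limit is almost surely unique.
  have h1 := tendstoInMeasure_of_tendsto_Lp (tendsto_riemannSum_intervalIntegral hF ht)
  have hae : ∀ n : ℕ, (∑ k ∈ Finset.range n, (t / n) • F (k * (t / n)) : Lp ℝ 2 P)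
      =ᵐ[P] fun ω => ∑ k ∈ Finset.range n, (t / n) • X (k * (t / n)) ω := by
    intro n
    have h2 : ∀ᵐ ω ∂P, ∀ k : ℕ, ((t / n) • F (k * (t / n)) : Lp ℝ 2 P) ω
        = (t / n) • X (k * (t / n)) ω := by
      refine ae_all_iff.2 fun k => ?_
      filter_upwards [Lp.coeFn_smul (t / n : ℝ) (F (k * (t / n))),
        hX (k * (t / n)) (by positivity)] with ω h3 h4
      simp [h3, h4]
    filter_upwards [h2, Lp.coeFn_finsetSum (Finset.range n)
      (fun k : ℕ => ((t / n) • F (k * (t / n)) : Lp ℝ 2 P))] with ω h3 h4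
    rw [h4, Finset.sum_apply]
    exact Finset.sum_congr rfl fun k _ => h3 k
  have h2 : TendstoInMeasure P (fun (n : ℕ) ω => ∑ k ∈ Finset.range n, (t / n) • X (k * (t / n)) ω)
      atTop (fun ω => ∫ u in (0 : ℝ)..t, X u ω) := by
    refine tendstoInMeasure_of_tendsto_ae (fun n => ?_) ?_
    · exact (Lp.aestronglyMeasurable _).congr (hae n)
    · filter_upwards [hc] with ω hω
      exact tendsto_riemannSum_intervalIntegral hω ht
  exact tendstoInMeasure_ae_unique h2 (h1.congr_left hae)

/-! ### Moments of a centred real Gaussian law -/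

lemma integral_pow_three_gaussianReal (v : ℝ≥0) : ∫ x, x ^ 3 ∂(gaussianReal 0 v) = 0 := by
  have h : ∫ x, x ^ 3 ∂(gaussianReal 0 v) = ∫ x, (-x) ^ 3 ∂(gaussianReal 0 v) := by
    conv_lhs => rw [← neg_zero, ← gaussianReal_map_neg]
    exact integral_map (by fun_prop) (by fun_prop)
  have h2 : ∫ x, (-x) ^ 3 ∂(gaussianReal 0 v) = -∫ x, x ^ 3 ∂(gaussianReal 0 v) := by
    rw [← integral_neg]; congr 1; ext x; ring
  linarith

lemma integral_pow_two_gaussianReal (v : ℝ≥0) : ∫ x, x ^ 2 ∂(gaussianReal 0 v) = v := by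
  have h := variance_fun_id_gaussianReal (μ := 0) (v := v)
  rw [variance_eq_integral (by fun_prop)] at h
  simpa using h

/-- The moment is the fourth derivative at 0 of the moment generating function exp(v t²/2). Each
differentiation replaces a polynomial prefactor q by q' + v t q, which `hstep` iterates. -/
lemma integral_pow_four_gaussianReal (v : ℝ≥0) :
    ∫ x, x ^ 4 ∂(gaussianReal 0 v) = 3 * (v : ℝ) ^ 2 := by
  have hE : ∀ t : ℝ, HasDerivAt (fun t : ℝ => Real.exp (v * t ^ 2 / 2))
      (v * t * Real.exp (v * t ^ 2 / 2)) t := by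
    intro t
    refine ((((hasDerivAt_id t).pow 2).const_mul (v : ℝ)).div_const 2).exp.congr_deriv ?_
    simp; ring
  have hstep : ∀ (q q' : ℝ → ℝ), (∀ t, HasDerivAt q (q' t) t) →
      deriv (fun t => q t * Real.exp (v * t ^ 2 / 2))
        = fun t => (q' t + v * t * q t) * Real.exp (v * t ^ 2 / 2) := by
    intro q q' hq
    ext t
    exact (((hq t).mul (hE t)).congr_deriv (by ring)).deriv
  have h4 : ∫ x, x ^ 4 ∂(gaussianReal 0 v)
      = iteratedDeriv 4 (mgf (fun x => x) (gaussianReal 0 v)) 0 := by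
    rw [iteratedDeriv_mgf_zero] <;> simp
  have h0 : mgf (fun x => x) (gaussianReal 0 v)
      = fun t => 1 * Real.exp (v * t ^ 2 / 2) := by
    rw [mgf_fun_id_gaussianReal]; simp
  rw [h4, h0, iteratedDeriv_succ, iteratedDeriv_succ, iteratedDeriv_succ, iteratedDeriv_one,
    hstep (fun _ => 1) (fun _ => 0) (fun t => hasDerivAt_const t 1),
    hstep (fun t => 0 + v * t * 1) (fun _ => v)
      (fun t => (((hasDerivAt_id t).const_mul (v : ℝ)).mul_const 1 |>.const_add 0).congr_deriv
        (by simp)),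
    hstep (fun t => v + v * t * (0 + v * t * 1)) (fun t => 2 * (v : ℝ) ^ 2 * t)
      (fun t => ((((hasDerivAt_id t).pow 2).const_mul ((v : ℝ) ^ 2) |>.const_add
        (v : ℝ)).congr_of_eventuallyEq (Eventually.of_forall fun s => by simp; ring)).congr_deriv
          (by simp; ring)),
    hstep (fun t => 2 * (v : ℝ) ^ 2 * t + v * t * (v + v * t * (0 + v * t * 1)))
      (fun t => 3 * (v : ℝ) ^ 2 + 3 * (v : ℝ) ^ 3 * t ^ 2)
      (fun t => ((((hasDerivAt_id t).const_mul (3 * (v : ℝ) ^ 2)).add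
        (((hasDerivAt_id t).pow 3).const_mul ((v : ℝ) ^ 3))).congr_of_eventuallyEq
          (Eventually.of_forall fun s => by simp; ring)).congr_deriv (by simp; ring))]
  simp

/-- A subspace of `L²` all of whose elements are centred Gaussian variables. -/
def IsGaussianSubspace (K : Submodule ℝ (Lp ℝ 2 P)) : Prop :=
  ∀ x ∈ K, HasLaw x (gaussianReal 0 (‖x‖₊ ^ 2)) P

/-- The map is |s|-Lipschitz: |exp(i a) - exp(i b)| ≤ |a - b|, and on a probability space the L¹
norm is at most the L² norm. This makes being centred Gaussian a closed condition. -/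
lemma continuous_integral_cexp_Lp [IsProbabilityMeasure P] (s : ℝ) :
    Continuous fun x : Lp ℝ 2 P => ∫ ω, Complex.exp (Complex.I * ((s * x ω : ℝ) : ℂ)) ∂P := by
  have hint : ∀ x : Lp ℝ 2 P,
      Integrable (fun ω => Complex.exp (Complex.I * ((s * x ω : ℝ) : ℂ))) P := by
    intro x
    have hm := (Lp.aestronglyMeasurable x).aemeasurable
    refine Integrable.of_bound (C := 1) ?_ (ae_of_all _ fun ω => ?_)
    · exact AEMeasurable.aestronglyMeasurable (by fun_prop)
    · rw [mul_comm, Complex.norm_exp_ofReal_mul_I]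
  have hL : LipschitzWith ⟨|s|, abs_nonneg s⟩
      fun x : Lp ℝ 2 P => ∫ ω, Complex.exp (Complex.I * ((s * x ω : ℝ) : ℂ)) ∂P := by
    refine LipschitzWith.of_dist_le_mul fun x y => ?_
    rw [dist_eq_norm, dist_eq_norm, ← integral_sub (hint x) (hint y)]
    have habs : MemLp (fun ω => |(x - y) ω|) 2 P := (Lp.memLp (x - y)).abs
    -- Nonnegativity of the variance of |x - y| is the required Cauchy–Schwarz inequality.
    have hL1 : ∫ ω, |(x - y) ω| ∂P ≤ ‖x - y‖ := by
      have h1 := variance_nonneg (fun ω => |(x - y) ω|) P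
      rw [variance_eq_sub habs] at h1
      have h2 : ∫ ω, ((fun ω => |(x - y) ω|) ^ 2) ω ∂P = ‖x - y‖ ^ 2 := by
        rw [norm_sq_Lp_eq_integral_sq]; simp
      rw [h2] at h1
      exact abs_le_of_sq_le_sq' (by linarith) (norm_nonneg _) |>.2
    calc _ ≤ ∫ ω, |s| * |(x - y) ω| ∂P := by
          refine norm_integral_le_of_norm_le ((habs.integrable (by norm_num)).const_mul _) ?_
          filter_upwards [Lp.coeFn_sub x y] with ω hω
          rw [hω, Pi.sub_apply, ← abs_mul]
          have : Complex.exp (Complex.I * ((s * x ω : ℝ) : ℂ))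
              - Complex.exp (Complex.I * ((s * y ω : ℝ) : ℂ))
              = Complex.exp (((s * y ω : ℝ) : ℂ) * Complex.I)
                * (Complex.exp (Complex.I * ((s * (x ω - y ω) : ℝ) : ℂ)) - 1) := by
            rw [mul_sub, ← Complex.exp_add, mul_one, mul_comm Complex.I ((s * y ω : ℝ) : ℂ)]
            congr 2
            push_cast; ring
          rw [this, norm_mul, Complex.norm_exp_ofReal_mul_I, one_mul]
          exact Real.norm_exp_I_mul_ofReal_sub_one_le
      _ = |s| * ∫ ω, |(x - y) ω| ∂P := integral_const_mul _ _
      _ ≤ |s| * ‖x - y‖ := by gcongr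
  exact hL.continuous

/-- The closure of a Gaussian subspace is Gaussian. -/
lemma IsGaussianSubspace.topologicalClosure [IsProbabilityMeasure P]
    {K : Submodule ℝ (Lp ℝ 2 P)} (hK : IsGaussianSubspace K) :
    IsGaussianSubspace K.topologicalClosure := by
  have hchar : ∀ (x : Lp ℝ 2 P) (s : ℝ), charFun (P.map x) s
      = ∫ ω, Complex.exp (Complex.I * ((s * x ω : ℝ) : ℂ)) ∂P := by
    intro x s
    rw [charFun_apply_real, integral_map (Lp.aestronglyMeasurable x).aemeasurable (by fun_prop)]
    congr 1; ext ω; congr 1; push_cast; ring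
  -- Being Gaussian with variance ‖x‖² is an equality of characteristic functions, both sides of
  -- which are continuous in `x` for each `s`.
  have hclosed : IsClosed {x : Lp ℝ 2 P | ∀ s : ℝ,
      ∫ ω, Complex.exp (Complex.I * ((s * x ω : ℝ) : ℂ)) ∂P
        = Complex.exp (-(((‖x‖ ^ 2 : ℝ) : ℂ) * s ^ 2 / 2))} := by
    simp only [Set.ofPred_forall]
    refine isClosed_iInter fun s => isClosed_eq (continuous_integral_cexp_Lp s) ?_
    fun_prop
  intro x hx
  have hxK : x ∈ closure (K : Set (Lp ℝ 2 P)) := hx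
  have hmem := closure_minimal (fun y hy s => ?_) hclosed hxK
  · refine ⟨(Lp.aestronglyMeasurable x).aemeasurable, ?_⟩
    have := Measure.isProbabilityMeasure_map (μ := P) (Lp.aestronglyMeasurable x).aemeasurable
    refine Measure.ext_of_charFun ?_
    ext s
    rw [hchar, hmem s, charFun_gaussianReal]
    simp
  · rw [← hchar, (hK y hy).map_eq, charFun_gaussianReal]
    simp

/-- Centred square integrable variables forming a Gaussian process span a Gaussian subspace. -/
lemma isGaussianSubspace_span_range {T : Type*} {X : T → Ω → ℝ}
    (hX : IsGaussianProcess X P) (hX0 : ∀ i, ∫ ω, X i ω ∂P = 0) {B : T → Lp ℝ 2 P}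
    (hB : ∀ i, X i =ᵐ[P] B i) : IsGaussianSubspace (Submodule.span ℝ (Set.range B)) := by
  intro x hx
  obtain ⟨c, rfl⟩ := Finsupp.mem_span_range_iff_exists_finsupp.1 hx
  have hg : HasGaussianLaw (fun ω => ∑ i ∈ c.support, c i • X i ω) P :=
    (hX.smul fun i => c i).hasGaussianLaw_fun_sum
  have hae : (fun ω => ∑ i ∈ c.support, c i • X i ω)
      =ᵐ[P] (c.sum fun i a => a • B i : Lp ℝ 2 P) := by
    have h2 : ∀ᵐ ω ∂P, ∀ i ∈ c.support, (c i • B i : Lp ℝ 2 P) ω = c i • X i ω := by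
      refine (Finset.eventually_all _).2 fun i _ => ?_
      filter_upwards [Lp.coeFn_smul (c i) (B i), hB i] with ω h3 h4
      simp [h3, h4]
    filter_upwards [h2, Lp.coeFn_finsetSum c.support
      (fun i => (c i • B i : Lp ℝ 2 P))] with ω h3 h4
    rw [Finsupp.sum, h4, Finset.sum_apply]
    exact (Finset.sum_congr rfl h3).symm
  set y : Lp ℝ 2 P := c.sum fun i a => a • B i with hy
  have hgy := hg.congr hae
  have := hgy.isProbabilityMeasure
  have hmean : ∫ ω, y ω ∂P = 0 := by
    rw [← integral_congr_ae hae, integral_finsetSum _ fun i _ => by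
      simpa using (hX.hasGaussianLaw_eval i).integrable.const_mul (c i)]
    simp [integral_const_mul, hX0]
  have hvar : Var[y; P] = ‖y‖ ^ 2 := by
    rw [variance_of_integral_eq_zero hgy.aemeasurable hmean, norm_sq_Lp_eq_integral_sq]
  refine ⟨hgy.aemeasurable, ?_⟩
  rw [hgy.map_eq_gaussianReal, hmean, hvar]
  congr 1
  ext
  simp

variable {K : Submodule ℝ (Lp ℝ 2 P)}

namespace IsGaussianSubspace

lemma memLp (hK : IsGaussianSubspace K) {x : Lp ℝ 2 P} (hx : x ∈ K) {p : ℝ≥0∞} (hp : p ≠ ∞) :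
    MemLp x p P :=
  (hK x hx).hasGaussianLaw.memLp hp

lemma integral_comp (hK : IsGaussianSubspace K) {x : Lp ℝ 2 P} (hx : x ∈ K) {f : ℝ → ℝ}
    (hf : Measurable f) : ∫ ω, f (x ω) ∂P = ∫ y, f y ∂(gaussianReal 0 (‖x‖₊ ^ 2)) :=
  (hK x hx).integral_comp hf.aestronglyMeasurable

lemma integral_eq_zero (hK : IsGaussianSubspace K) {x : Lp ℝ 2 P} (hx : x ∈ K) :
    ∫ ω, x ω ∂P = 0 := by
  simpa using hK.integral_comp hx measurable_id

lemma integral_pow_two (hK : IsGaussianSubspace K) {x : Lp ℝ 2 P} (hx : x ∈ K) :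
    ∫ ω, x ω ^ 2 ∂P = ‖x‖ ^ 2 := by
  rw [hK.integral_comp hx (f := fun y => y ^ 2) (by fun_prop), integral_pow_two_gaussianReal]
  simp

lemma integral_pow_three (hK : IsGaussianSubspace K) {x : Lp ℝ 2 P} (hx : x ∈ K) :
    ∫ ω, x ω ^ 3 ∂P = 0 := by
  rw [hK.integral_comp hx (f := fun y => y ^ 3) (by fun_prop), integral_pow_three_gaussianReal]

lemma integral_pow_four (hK : IsGaussianSubspace K) {x : Lp ℝ 2 P} (hx : x ∈ K) :
    ∫ ω, x ω ^ 4 ∂P = 3 * (‖x‖ ^ 2) ^ 2 := by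
  rw [hK.integral_comp hx (f := fun y => y ^ 4) (by fun_prop), integral_pow_four_gaussianReal]
  simp

lemma memLp_sq (hK : IsGaussianSubspace K) {x : Lp ℝ 2 P} (hx : x ∈ K) :
    MemLp (fun ω => x ω ^ 2) 2 P := by
  have hm := Lp.aestronglyMeasurable x
  refine (memLp_two_iff_integrable_sq (hm.pow 2)).2 ?_
  have := (hK x hx).hasGaussianLaw.isProbabilityMeasure
  have h4 : MemLp x (4 : ℕ) P := hK.memLp hx (by simp)
  refine h4.integrable_norm_pow'.congr (ae_of_all _ fun ω => ?_)
  simp only [Real.norm_eq_abs, Pi.pow_apply]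
  rw [← pow_mul, ← abs_pow, abs_of_nonneg (Even.pow_nonneg ⟨2, rfl⟩ _)]

end IsGaussianSubspace

/-- The square of an element of `L²`, as an element of `L²` (zero if it is not in `L²`). -/
def sqLp (x : Lp ℝ 2 P) : Lp ℝ 2 P :=
  open Classical in if h : MemLp (fun ω => x ω ^ 2) 2 P then h.toLp _ else 0

namespace IsGaussianSubspace

lemma coeFn_sqLp (hK : IsGaussianSubspace K) {x : Lp ℝ 2 P} (hx : x ∈ K) :
    sqLp x =ᵐ[P] fun ω => x ω ^ 2 := by
  rw [sqLp, dif_pos (hK.memLp_sq hx)]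
  exact MemLp.coeFn_toLp _

lemma integral_sqLp (hK : IsGaussianSubspace K) {x : Lp ℝ 2 P} (hx : x ∈ K) :
    ∫ ω, sqLp x ω ∂P = ‖x‖ ^ 2 := by
  rw [integral_congr_ae (hK.coeFn_sqLp hx), hK.integral_pow_two hx]

/-- The Isserlis formula for the third moments. -/
lemma inner_sqLp_left (hK : IsGaussianSubspace K) {x y : Lp ℝ 2 P} (hx : x ∈ K) (hy : y ∈ K) :
    ⟪sqLp x, y⟫_ℝ = 0 := by
  have hxy : Integrable (fun ω => x ω ^ 2 * y ω) P := (hK.memLp_sq hx).integrable_mul (Lp.memLp y)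
  have hi : ∀ {z : Lp ℝ 2 P}, z ∈ K → Integrable (fun ω => z ω ^ 3) P := by
    intro z hz
    refine ((hK.memLp_sq hz).integrable_mul (Lp.memLp z)).congr (ae_of_all _ fun ω => ?_)
    simp only [Pi.mul_apply]; ring
  have hp := hK.integral_pow_three (K.add_mem hx hy)
  have hm := hK.integral_pow_three (K.sub_mem hx hy)
  -- Polarisation: (x+y)³ - (x-y)³ = 6x²y + 2y³, and every third moment of an element of `K`
  -- vanishes.
  have key : ∫ ω, (x + y) ω ^ 3 - (x - y) ω ^ 3 ∂P
      = ∫ ω, 6 * (x ω ^ 2 * y ω) + 2 * (y ω ^ 3) ∂P := by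
    refine integral_congr_ae ?_
    filter_upwards [Lp.coeFn_add x y, Lp.coeFn_sub x y] with ω h1 h2
    simp only [h1, h2, Pi.add_apply, Pi.sub_apply]; ring
  rw [integral_sub (hi (K.add_mem hx hy)) (hi (K.sub_mem hx hy)), hp, hm,
    integral_add (hxy.const_mul 6) ((hi hy).const_mul 2), integral_const_mul, integral_const_mul,
    hK.integral_pow_three hy] at key
  rw [inner_Lp_eq_integral_mul]
  have : ∫ ω, sqLp x ω * y ω ∂P = ∫ ω, x ω ^ 2 * y ω ∂P := by
    refine integral_congr_ae ?_
    filter_upwards [hK.coeFn_sqLp hx] with ω h1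
    rw [h1]
  linarith

/-- The Isserlis formula for the fourth moments of the form `E[x² y²]`. -/
lemma inner_sqLp_sqLp (hK : IsGaussianSubspace K) {x y : Lp ℝ 2 P} (hx : x ∈ K) (hy : y ∈ K) :
    ⟪sqLp x, sqLp y⟫_ℝ = ‖x‖ ^ 2 * ‖y‖ ^ 2 + 2 * ⟪x, y⟫_ℝ ^ 2 := by
  have hxy : Integrable (fun ω => x ω ^ 2 * y ω ^ 2) P :=
    (hK.memLp_sq hx).integrable_mul (hK.memLp_sq hy)
  have hi : ∀ {z : Lp ℝ 2 P}, z ∈ K → Integrable (fun ω => z ω ^ 4) P := by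
    intro z hz
    refine ((hK.memLp_sq hz).integrable_mul (hK.memLp_sq hz)).congr (ae_of_all _ fun ω => ?_)
    simp only [Pi.mul_apply]; ring
  have hp := hK.integral_pow_four (K.add_mem hx hy)
  have hm := hK.integral_pow_four (K.sub_mem hx hy)
  -- Polarisation: (x+y)⁴ + (x-y)⁴ = 12x²y² + 2x⁴ + 2y⁴, with the pure fourth moments given by the
  -- norms.
  have key : ∫ ω, (x + y) ω ^ 4 + (x - y) ω ^ 4 ∂P
      = ∫ ω, 12 * (x ω ^ 2 * y ω ^ 2) + (2 * (x ω ^ 4) + 2 * (y ω ^ 4)) ∂P := by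
    refine integral_congr_ae ?_
    filter_upwards [Lp.coeFn_add x y, Lp.coeFn_sub x y] with ω h1 h2
    simp only [h1, h2, Pi.add_apply, Pi.sub_apply]; ring
  rw [integral_add (hi (K.add_mem hx hy)) (hi (K.sub_mem hx hy)), hp, hm,
    integral_add (hxy.const_mul 12) (((hi hx).const_mul 2).fun_add ((hi hy).const_mul 2)),
    integral_add ((hi hx).const_mul 2) ((hi hy).const_mul 2), integral_const_mul,
    integral_const_mul, integral_const_mul, hK.integral_pow_four hx, hK.integral_pow_four hy,
    norm_add_sq_real, norm_sub_sq_real] at key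
  rw [inner_Lp_eq_integral_mul]
  have : ∫ ω, sqLp x ω * sqLp y ω ∂P = ∫ ω, x ω ^ 2 * y ω ^ 2 ∂P := by
    refine integral_congr_ae ?_
    filter_upwards [hK.coeFn_sqLp hx, hK.coeFn_sqLp hy] with ω h1 h2
    rw [h1, h2]
  rw [this]
  linear_combination -key / 12

/-- Squaring is continuous on a Gaussian subspace. -/
lemma continuous_sqLp_comp (hK : IsGaussianSubspace K) {Z : ℝ → Lp ℝ 2 P} (hZ : Continuous Z)
    (hZK : ∀ t, Z t ∈ K) : Continuous fun t => sqLp (Z t) := by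
  refine continuous_iff_continuousAt.2 fun s => tendsto_iff_norm_sub_tendsto_zero.2 ?_
  -- By Isserlis the distance between two squares depends only on norms and inner products in `K`,
  -- which are continuous along `Z`.
  have hnorm : ∀ t, ‖sqLp (Z t) - sqLp (Z s)‖
      = √(3 * (‖Z t‖ ^ 2) ^ 2 - 2 * (‖Z t‖ ^ 2 * ‖Z s‖ ^ 2 + 2 * ⟪Z t, Z s⟫_ℝ ^ 2)
        + 3 * (‖Z s‖ ^ 2) ^ 2) := by
    intro t
    rw [← Real.sqrt_sq (norm_nonneg (sqLp (Z t) - sqLp (Z s))), norm_sub_sq_real,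
      hK.inner_sqLp_sqLp (hZK t) (hZK s), ← real_inner_self_eq_norm_sq,
      ← real_inner_self_eq_norm_sq (sqLp (Z s)), hK.inner_sqLp_sqLp (hZK t) (hZK t),
      hK.inner_sqLp_sqLp (hZK s) (hZK s), real_inner_self_eq_norm_sq, real_inner_self_eq_norm_sq]
    congr 1
    ring
  simp_rw [hnorm]
  have hc : Continuous fun t => √(3 * (‖Z t‖ ^ 2) ^ 2
      - 2 * (‖Z t‖ ^ 2 * ‖Z s‖ ^ 2 + 2 * ⟪Z t, Z s⟫_ℝ ^ 2) + 3 * (‖Z s‖ ^ 2) ^ 2) := by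
    fun_prop
  convert hc.tendsto s using 2
  rw [real_inner_self_eq_norm_sq, eq_comm, Real.sqrt_eq_zero']
  exact le_of_eq (by ring)

end IsGaussianSubspace

/-! ### Correlated Brownian motions as curves in `L²` -/

section BrownianPair

variable {W₁ W₂ : ℝ≥0 → Ω → ℝ} {ρ : ℝ}

namespace IsCorrelatedBrownianPair

/-- Independent Gaussian increments make the planar process Gaussian. Indexing by a disjoint union
expresses joint Gaussianity, so that mixed linear combinations of the two motions are Gaussian. -/
lemma isGaussianProcess (hW : IsCorrelatedBrownianPair W₁ W₂ ρ P) :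
    IsGaussianProcess (Sum.elim W₁ W₂) P := by
  have h0 : ∀ᵐ ω ∂P, (W₁ 0 ω, W₂ 0 ω) = 0 := by
    filter_upwards [hW.fst.eval_zero_ae_eq_zero, hW.snd.eval_zero_ae_eq_zero] with ω h1 h2
    simp [h1, h2]
  have hpair : IsGaussianProcess (fun t ω => (W₁ t ω, W₂ t ω)) P := by
    refine hW.indep.isGaussianProcess (fun t => (hW.gaussian 0 t zero_le).congr ?_) h0
    filter_upwards [h0] with ω hω
    obtain ⟨h1, h2⟩ := Prod.mk.inj hω
    simp [h1, h2]
  refine hpair.of_isGaussianProcess ?_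
  rintro (t | t)
  · exact ⟨{t}, (ContinuousLinearMap.fst ℝ ℝ ℝ).comp (.proj ⟨t, by simp⟩), fun ω => by simp⟩
  · exact ⟨{t}, (ContinuousLinearMap.snd ℝ ℝ ℝ).comp (.proj ⟨t, by simp⟩), fun ω => by simp⟩

/-- The motion at the later time is its value at the earlier time plus an increment independent of
the planar past; only the diagonal covariance survives. -/
lemma covariance_eval (hW : IsCorrelatedBrownianPair W₁ W₂ ρ P) (s t : ℝ≥0) :
    cov[W₁ s, W₂ t; P] = ρ * min s t := by
  have hP := hW.isGaussianProcess.isProbabilityMeasure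
  have hL1 : ∀ t, MemLp (W₁ t) 2 P := fun t =>
    (hW.fst.isGaussianProcess.hasGaussianLaw_eval t).memLp_two
  have hL2 : ∀ t, MemLp (W₂ t) 2 P := fun t =>
    (hW.snd.isGaussianProcess.hasGaussianLaw_eval t).memLp_two
  have h0 : ∀ᵐ ω ∂P, (W₁ 0 ω, W₂ 0 ω) = 0 := by
    filter_upwards [hW.fst.eval_zero_ae_eq_zero, hW.snd.eval_zero_ae_eq_zero] with ω h1 h2
    simp [h1, h2]
  have hdiag : ∀ t : ℝ≥0, cov[W₁ t, W₂ t; P] = ρ * t := by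
    intro t
    have := hW.cov_increments 0 t zero_le
    change cov[W₁ t - W₁ 0, W₂ t - W₂ 0; P] = _ at this
    rw [covariance_eq_sub ((hL1 t).sub (hL1 0)) ((hL2 t).sub (hL2 0))] at this
    rw [covariance_eq_sub (hL1 t) (hL2 t)]
    have e1 : W₁ t - W₁ 0 =ᵐ[P] W₁ t := by
      filter_upwards [hW.fst.eval_zero_ae_eq_zero] with ω h1
      simp [h1]
    have e2 : W₂ t - W₂ 0 =ᵐ[P] W₂ t := by
      filter_upwards [hW.snd.eval_zero_ae_eq_zero] with ω h1
      simp [h1]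
    rw [integral_congr_ae (e1.mul e2), integral_congr_ae e1, integral_congr_ae e2] at this
    simpa using this
  rcases le_total s t with hst | hst
  · have hi := (hW.indep.indepFun_eval_sub zero_le hst h0).comp measurable_fst measurable_snd
    have h2 : W₂ t = (W₂ t - W₂ s) + W₂ s := by simp
    rw [min_eq_left hst, h2, covariance_add_right (hL1 s) ((hL2 t).sub (hL2 s)) (hL2 s), hdiag]
    have : cov[W₁ s, W₂ t - W₂ s; P] = 0 :=
      hi.covariance_eq_zero (hL1 s) ((hL2 t).sub (hL2 s))
    rw [this, zero_add]
  · have hi := (hW.indep.indepFun_eval_sub zero_le hst h0).comp measurable_snd measurable_fst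
    have h2 : W₁ s = (W₁ s - W₁ t) + W₁ t := by simp
    rw [min_eq_right hst, h2, covariance_add_left ((hL1 s).sub (hL1 t)) (hL1 t) (hL2 t), hdiag]
    have : cov[W₁ s - W₁ t, W₂ t; P] = 0 := by
      rw [covariance_comm]
      exact hi.covariance_eq_zero (hL2 t) ((hL1 s).sub (hL1 t))
    rw [this, zero_add]

end IsCorrelatedBrownianPair

/-- A Brownian motion as a curve in `L²`, extended by its initial value to negative times. -/
def brownianCurve {W : ℝ≥0 → Ω → ℝ} (hW : IsPreBrownianReal W P) (t : ℝ) : Lp ℝ 2 P :=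
  (hW.isGaussianProcess.hasGaussianLaw_eval t.toNNReal).memLp_two.toLp (W t.toNNReal)

lemma coeFn_brownianCurve {W : ℝ≥0 → Ω → ℝ} (hW : IsPreBrownianReal W P) (t : ℝ) :
    brownianCurve hW t =ᵐ[P] W t.toNNReal :=
  MemLp.coeFn_toLp _

lemma inner_brownianCurve (hW₁ : IsPreBrownianReal W₁ P) (hW₂ : IsPreBrownianReal W₂ P)
    (s t : ℝ) :
    ⟪brownianCurve hW₁ s, brownianCurve hW₂ t⟫_ℝ = cov[W₁ s.toNNReal, W₂ t.toNNReal; P] := by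
  have := hW₁.isGaussianProcess.isProbabilityMeasure
  rw [inner_Lp_eq_integral_mul, covariance_eq_sub
    (hW₁.isGaussianProcess.hasGaussianLaw_eval _).memLp_two
    (hW₂.isGaussianProcess.hasGaussianLaw_eval _).memLp_two, hW₁.integral_eval]
  simp only [zero_mul, sub_zero]
  refine integral_congr_ae ?_
  filter_upwards [coeFn_brownianCurve hW₁ s, coeFn_brownianCurve hW₂ t] with ω h1 h2
  simp [h1, h2]

lemma continuous_brownianCurve {W : ℝ≥0 → Ω → ℝ} (hW : IsPreBrownianReal W P) :
    Continuous (brownianCurve hW) := by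
  refine continuous_iff_continuousAt.2 fun s => tendsto_iff_norm_sub_tendsto_zero.2 ?_
  have hnorm : ∀ t, ‖brownianCurve hW t - brownianCurve hW s‖
      = √((t.toNNReal : ℝ) - 2 * min (t.toNNReal : ℝ) s.toNNReal + s.toNNReal) := by
    intro t
    rw [← Real.sqrt_sq (norm_nonneg (brownianCurve hW t - brownianCurve hW s)), norm_sub_sq_real,
      ← real_inner_self_eq_norm_sq, ← real_inner_self_eq_norm_sq, inner_brownianCurve,
      inner_brownianCurve, inner_brownianCurve, hW.covariance_eval, hW.covariance_eval,
      hW.covariance_eval]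
    simp
  simp_rw [hnorm]
  have hc : Continuous fun t : ℝ =>
      √((t.toNNReal : ℝ) - 2 * min (t.toNNReal : ℝ) s.toNNReal + s.toNNReal) := by
    fun_prop
  convert hc.tendsto s using 2
  rw [min_self, eq_comm, Real.sqrt_eq_zero']
  exact le_of_eq (by ring)

/-- The closure of the joint span is needed because Ornstein–Uhlenbeck curves involve integrals,
which are only limits of linear combinations. -/
lemma IsCorrelatedBrownianPair.exists_isGaussianSubspace
    (hW : IsCorrelatedBrownianPair W₁ W₂ ρ P) :
    ∃ K : Submodule ℝ (Lp ℝ 2 P), IsGaussianSubspace K ∧ IsClosed (K : Set (Lp ℝ 2 P)) ∧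
      (∀ t, brownianCurve hW.fst.toIsPreBrownianReal t ∈ K) ∧
      ∀ t, brownianCurve hW.snd.toIsPreBrownianReal t ∈ K := by
  have hP := hW.isGaussianProcess.isProbabilityMeasure
  have hspan := isGaussianSubspace_span_range hW.isGaussianProcess
    (B := Sum.elim (fun t : ℝ≥0 => brownianCurve hW.fst.toIsPreBrownianReal t)
      (fun t : ℝ≥0 => brownianCurve hW.snd.toIsPreBrownianReal t))
    (by rintro (t | t)
        · exact hW.fst.integral_eval t
        · exact hW.snd.integral_eval t)
    (by rintro (t | t)
        · simpa using (coeFn_brownianCurve hW.fst.toIsPreBrownianReal (t : ℝ)).symm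
        · simpa using (coeFn_brownianCurve hW.snd.toIsPreBrownianReal (t : ℝ)).symm)
  refine ⟨_, hspan.topologicalClosure, Submodule.isClosed_topologicalClosure _,
    fun t => Submodule.le_topologicalClosure _ (Submodule.subset_span ⟨Sum.inl t.toNNReal, ?_⟩),
    fun t => Submodule.le_topologicalClosure _ (Submodule.subset_span ⟨Sum.inr t.toNNReal, ?_⟩)⟩
  all_goals simp [brownianCurve]

end BrownianPair

end GaussianSubspace

/-! ### The moment functions -/

namespace SSVParams

variable (p : SSVParams)

/-- The variance of the sentiment. -/
def varS (t : ℝ) : ℝ := p.sigS ^ 2 / (2 * p.lamS) * (1 - Real.exp (-2 * p.lamS * t))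

/-- The covariance of sentiment and volatility. -/
def covSV (t : ℝ) : ℝ :=
  ∫ u in (0 : ℝ)..t, Real.exp ((p.gamV + p.lamS) * (u - t)) *
    (2 * p.betaV * (p.mS u - p.muS) * p.varS u + p.sigS * p.sigV * p.rhoSV)

/-- The covariance of the squared centred sentiment and the volatility. -/
def covSqV (t : ℝ) : ℝ :=
  ∫ u in (0 : ℝ)..t, Real.exp ((p.gamV + 2 * p.lamS) * (u - t)) *
    (2 * p.betaV * p.varS u ^ 2)

lemma mS2_eq (t : ℝ) : p.mS2 t = p.varS t + p.mS t ^ 2 := rfl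

lemma mS3_eq (t : ℝ) : p.mS3 t = p.mS t ^ 3 + 3 * p.mS t * p.varS t := by
  rw [mS3, mS2_eq]; ring

lemma mS4_eq (t : ℝ) :
    p.mS4 t = p.mS t ^ 4 + 6 * p.mS t ^ 2 * p.varS t + 3 * p.varS t ^ 2 := by
  rw [mS4, mS2_eq]; ring

/-- This is the form in which the variance arises from `inner_ouCurve_ouCurve`. -/
lemma varS_eq (hlam : p.lamS ≠ 0) (t : ℝ) :
    p.varS t = p.sigS ^ 2 * ∫ u in (0 : ℝ)..t, Real.exp (2 * p.lamS * (u - t)) := by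
  have := integral_exp_mul_eq (2 * p.lamS) t
  rw [varS, div_mul_eq_mul_div, div_eq_iff (by positivity)]
  rw [show -2 * p.lamS * t = -(2 * p.lamS) * t by ring, ← this]
  ring

lemma hasDerivAt_exp_neg_mul (a t : ℝ) :
    HasDerivAt (fun t : ℝ => Real.exp (-a * t)) (-a * Real.exp (-a * t)) t := by
  simpa [mul_comm] using ((hasDerivAt_id t).const_mul (-a)).exp

lemma hasDerivAt_mS (t : ℝ) : HasDerivAt p.mS (-(p.lamS * (p.mS t - p.muS))) t := by
  have h := hasDerivAt_exp_neg_mul p.lamS t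
  refine ((h.mul_const p.S0).add ((h.const_sub 1).const_mul p.muS)).congr_deriv ?_
  rw [mS]; ring

lemma hasDerivAt_varS (hlam : p.lamS ≠ 0) (t : ℝ) :
    HasDerivAt p.varS (p.sigS ^ 2 - 2 * p.lamS * p.varS t) t := by
  have h := hasDerivAt_exp_neg_mul (2 * p.lamS) t
  have h2 := (h.const_sub 1).const_mul (p.sigS ^ 2 / (2 * p.lamS))
  simp only [← neg_mul] at h2
  refine h2.congr_deriv ?_
  rw [varS]
  field_simp
  ring

lemma continuous_mS : Continuous p.mS := by unfold mS; fun_prop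

lemma continuous_varS : Continuous p.varS := by unfold varS; fun_prop

lemma continuous_mS2 : Continuous p.mS2 := p.continuous_varS.add (p.continuous_mS.pow 2)

lemma continuous_mS3 : Continuous p.mS3 := by
  have := p.continuous_mS
  have := p.continuous_mS2
  unfold mS3; fun_prop

lemma continuous_mS4 : Continuous p.mS4 := by
  have := p.continuous_mS
  have := p.continuous_mS2
  unfold mS4; fun_prop

lemma hasDerivAt_mV (t : ℝ) :
    HasDerivAt p.mV (-(p.gamV * p.mV t)
      + (p.muV + p.betaV * (p.mS2 t - 2 * p.muS * p.mS t + p.muS ^ 2))) t := by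
  have := p.continuous_mS
  have := p.continuous_mS2
  exact hasDerivAt_variationOfConstants p.gamV p.V0
    (f := fun u => p.muV + p.betaV * (p.mS2 u - 2 * p.muS * p.mS u + p.muS ^ 2)) (by fun_prop) t

lemma continuous_mV : Continuous p.mV :=
  continuous_iff_continuousAt.2 fun t => (p.hasDerivAt_mV t).continuousAt

lemma hasDerivAt_covSV (t : ℝ) :
    HasDerivAt p.covSV (-((p.gamV + p.lamS) * p.covSV t)
      + (2 * p.betaV * (p.mS t - p.muS) * p.varS t + p.sigS * p.sigV * p.rhoSV)) t := by
  have := p.continuous_mS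
  have := p.continuous_varS
  exact hasDerivAt_expConvolution (p.gamV + p.lamS) (f := fun u => 2 * p.betaV * (p.mS u - p.muS)
    * p.varS u + p.sigS * p.sigV * p.rhoSV) (by fun_prop) t

lemma continuous_covSV : Continuous p.covSV :=
  continuous_iff_continuousAt.2 fun t => (p.hasDerivAt_covSV t).continuousAt

lemma hasDerivAt_covSqV (t : ℝ) :
    HasDerivAt p.covSqV (-((p.gamV + 2 * p.lamS) * p.covSqV t)
      + 2 * p.betaV * p.varS t ^ 2) t := by
  have := p.continuous_varS
  exact hasDerivAt_expConvolution (p.gamV + 2 * p.lamS)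
    (f := fun u => 2 * p.betaV * p.varS u ^ 2) (by fun_prop) t

lemma continuous_covSqV : Continuous p.covSqV :=
  continuous_iff_continuousAt.2 fun t => (p.hasDerivAt_covSqV t).continuousAt

/-! ### Initial values, and the moment formulas in terms of central moments -/

lemma mS_zero : p.mS 0 = p.S0 := by simp [mS]

lemma varS_zero : p.varS 0 = 0 := by simp [varS]

lemma mV_zero : p.mV 0 = p.V0 := by simp [mV]

lemma covSV_zero : p.covSV 0 = 0 := by simp [covSV]

lemma covSqV_zero : p.covSqV 0 = 0 := by simp [covSqV]

/-- The right-hand side satisfies the linear equation with rate `gamV + lamS` whose variation of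
constants formula defines `mSV`, with the same initial value. -/
lemma mSV_eq (t : ℝ) : p.mSV t = p.mS t * p.mV t + p.covSV t := by
  have := p.continuous_mS
  have := p.continuous_mS2
  have := p.continuous_mS3
  have := p.continuous_mV
  have h := eq_variationOfConstants (a := p.gamV + p.lamS)
    (g := fun t => p.mS t * p.mV t + p.covSV t)
    (f := fun u => p.lamS * p.muS * p.mV u + p.sigS * p.sigV * p.rhoSV
          + (p.muV + p.betaV * p.muS ^ 2) * p.mS u
          - 2 * (p.betaV * p.muS) * p.mS2 u
          + p.betaV * p.mS3 u) (by fun_prop)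
    (fun t => (((p.hasDerivAt_mS t).mul (p.hasDerivAt_mV t)).add
      (p.hasDerivAt_covSV t)).congr_deriv (by
        simp only [smul_eq_mul, mS3_eq, mS2_eq]; ring)) t
  simp only [smul_eq_mul, mS_zero, mV_zero, covSV_zero, add_zero] at h
  rw [h, mSV]

lemma continuous_mSV : Continuous p.mSV := by
  have := p.continuous_mS
  have := p.continuous_mV
  have := p.continuous_covSV
  rw [funext p.mSV_eq]
  fun_prop

/-- With S = `mS` + Z this is the expansion of E[S²V]; it satisfies the linear equation with rate
`gamV + 2 * lamS` solved by `mS2V`. -/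
lemma mS2V_eq (hlam : p.lamS ≠ 0) (t : ℝ) :
    p.mS2V t = p.mS2 t * p.mV t + 2 * p.mS t * p.covSV t + p.covSqV t := by
  have := p.continuous_mS
  have := p.continuous_mS2
  have := p.continuous_mS3
  have := p.continuous_mS4
  have := p.continuous_mV
  have := p.continuous_mSV
  have h := eq_variationOfConstants (a := p.gamV + 2 * p.lamS)
    (g := fun t => (p.varS t + p.mS t ^ 2) * p.mV t + 2 * p.mS t * p.covSV t + p.covSqV t)
    (f := fun u => 2 * p.sigV * p.sigS * p.rhoSV * p.mS u
          + (p.muV + p.betaV * p.muS ^ 2) * p.mS2 u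
          - 2 * p.muS * p.betaV * p.mS3 u
          + p.betaV * p.mS4 u
          + 2 * p.lamS * p.muS * p.mSV u
          + p.sigS ^ 2 * p.mV u) (by fun_prop)
    (fun t => (((((p.hasDerivAt_varS hlam t).add ((p.hasDerivAt_mS t).pow 2)).mul
      (p.hasDerivAt_mV t)).add (((p.hasDerivAt_mS t).const_mul 2).mul (p.hasDerivAt_covSV t))).add
      (p.hasDerivAt_covSqV t)).congr_deriv (by
        simp only [smul_eq_mul, mSV_eq, mS4_eq, mS3_eq, mS2_eq, Pi.add_apply, Pi.pow_apply]
        push_cast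
        ring)) t
  simp only [smul_eq_mul, mS_zero, mV_zero, varS_zero, covSV_zero, covSqV_zero, add_zero,
    zero_add, mul_zero] at h
  rw [mS2_eq, h, mS2V]

lemma varS_pos (hlam : p.lamS ≠ 0) (hsig : p.sigS ≠ 0) {t : ℝ} (ht : 0 < t) : 0 < p.varS t := by
  rw [p.varS_eq hlam]
  have : 0 < ∫ u in (0 : ℝ)..t, Real.exp (2 * p.lamS * (u - t)) :=
    intervalIntegral.intervalIntegral_pos_of_pos
      (Continuous.intervalIntegrable (by fun_prop) _ _) (fun _ => Real.exp_pos _) ht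
  positivity

/-- After `2 * betaV` is factored out, the integrand is positive because `varS` is positive at
positive times. -/
lemma covSqV_ne_zero (hlam : p.lamS ≠ 0) (hsig : p.sigS ≠ 0) (hbeta : p.betaV ≠ 0) {t : ℝ}
    (ht : 0 < t) : p.covSqV t ≠ 0 := by
  have hc := p.continuous_varS
  have hpos : 0 < ∫ u in (0 : ℝ)..t, Real.exp ((p.gamV + 2 * p.lamS) * (u - t)) * p.varS u ^ 2 := by
    refine intervalIntegral.intervalIntegral_pos_of_pos_on
      (Continuous.intervalIntegrable (by fun_prop) _ _) (fun u hu => ?_) ht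
    have := p.varS_pos hlam hsig hu.1
    positivity
  have : p.covSqV t = 2 * p.betaV *
      ∫ u in (0 : ℝ)..t, Real.exp ((p.gamV + 2 * p.lamS) * (u - t)) * p.varS u ^ 2 := by
    rw [covSqV, ← intervalIntegral.integral_const_mul]
    congr 1; ext u; ring
  rw [this]
  positivity

end SSVParams

/-! ### The solution as a curve in `L²` -/

section SolutionCurve

open scoped InnerProductSpace

variable {Ω : Type*} [MeasurableSpace Ω] {P : Measure Ω}

/-- `Z` and `Y` are the centred Ornstein–Uhlenbeck parts of the sentiment and of the volatility,
as curves in a Gaussian subspace of `L²`. -/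
structure IsGaussianPart (p : SSVParams) (K : Submodule ℝ (Lp ℝ 2 P)) (Z Y : ℝ → Lp ℝ 2 P) :
    Prop where
  isGaussianSubspace : IsGaussianSubspace K
  continuous_fst : Continuous Z
  continuous_snd : Continuous Y
  fst_mem : ∀ t, Z t ∈ K
  snd_mem : ∀ t, Y t ∈ K
  inner_fst_fst : ∀ {s t}, 0 ≤ s → s ≤ t →
    ⟪Z s, Z t⟫_ℝ = Real.exp (p.lamS * (s - t)) * p.varS s
  inner_fst_snd : ∀ {s t}, 0 ≤ s → s ≤ t →
    ⟪Z s, Y t⟫_ℝ = Real.exp (p.gamV * (s - t)) *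
      (p.sigS * p.sigV * p.rhoSV * ∫ u in (0 : ℝ)..s, Real.exp ((p.lamS + p.gamV) * (u - s)))
  inner_snd_snd : ∀ {t}, 0 ≤ t →
    ⟪Y t, Y t⟫_ℝ = p.sigV ^ 2 * ∫ u in (0 : ℝ)..t, Real.exp (2 * p.gamV * (u - t))

lemma IsGaussianPart.norm_fst_sq {p : SSVParams} {K : Submodule ℝ (Lp ℝ 2 P)}
    {Z Y : ℝ → Lp ℝ 2 P} (h : IsGaussianPart p K Z Y) {t : ℝ} (ht : 0 ≤ t) :
    ‖Z t‖ ^ 2 = p.varS t := by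
  rw [← real_inner_self_eq_norm_sq, h.inner_fst_fst ht le_rfl]
  simp

variable [IsProbabilityMeasure P]

lemma inner_const_one_left (f : Lp ℝ 2 P) : ⟪Lp.const 2 P (1 : ℝ), f⟫_ℝ = ∫ ω, f ω ∂P := by
  rw [inner_Lp_eq_integral_mul]
  refine integral_congr_ae ?_
  filter_upwards [Lp.coeFn_const (p := 2) (μ := P) (1 : ℝ)] with ω h
  rw [h, Function.const_apply, one_mul]

lemma inner_const_one_right (f : Lp ℝ 2 P) : ⟪f, Lp.const 2 P (1 : ℝ)⟫_ℝ = ∫ ω, f ω ∂P := by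
  rw [real_inner_comm, inner_const_one_left]

lemma inner_const_one_self : ⟪Lp.const 2 P (1 : ℝ), Lp.const 2 P (1 : ℝ)⟫_ℝ = 1 := by
  rw [inner_const_one_left, integral_congr_ae (Lp.coeFn_const (p := 2) (μ := P) (1 : ℝ))]
  simp

namespace SSVParams

variable (p : SSVParams)

/-- The inhomogeneous part of the drift of the volatility, for the centred sentiment `Z`. -/
def sourceCurve (Z : ℝ → Lp ℝ 2 P) (u : ℝ) : Lp ℝ 2 P :=
  (p.muV + p.betaV * (p.mS u - p.muS) ^ 2) • Lp.const 2 P (1 : ℝ)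
    + (2 * p.betaV * (p.mS u - p.muS)) • Z u + p.betaV • sqLp (Z u)

/-- The part of the volatility of bounded variation. -/
def driftCurve (Z : ℝ → Lp ℝ 2 P) (t : ℝ) : Lp ℝ 2 P :=
  Real.exp (-p.gamV * t) • p.V0 • Lp.const 2 P (1 : ℝ)
    + ∫ u in (0 : ℝ)..t, Real.exp (p.gamV * (u - t)) • p.sourceCurve Z u

/-- The volatility as a curve in `L²`. -/
def volCurve (Z Y : ℝ → Lp ℝ 2 P) (t : ℝ) : Lp ℝ 2 P := p.driftCurve Z t + Y t

end SSVParams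

namespace IsGaussianPart

variable {p : SSVParams} {K : Submodule ℝ (Lp ℝ 2 P)} {Z Y : ℝ → Lp ℝ 2 P}

lemma continuous_sourceCurve (h : IsGaussianPart p K Z Y) : Continuous (p.sourceCurve Z) := by
  have h1 := h.isGaussianSubspace.continuous_sqLp_comp h.continuous_fst h.fst_mem
  have h2 := h.continuous_fst
  have h3 := p.continuous_mS
  unfold SSVParams.sourceCurve
  fun_prop

lemma hasDerivAt_driftCurve (h : IsGaussianPart p K Z Y) (t : ℝ) :
    HasDerivAt (p.driftCurve Z) (-(p.gamV • p.driftCurve Z t) + p.sourceCurve Z t) t :=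
  hasDerivAt_variationOfConstants p.gamV _ h.continuous_sourceCurve t

lemma continuous_driftCurve (h : IsGaussianPart p K Z Y) : Continuous (p.driftCurve Z) :=
  continuous_iff_continuousAt.2 fun t => (h.hasDerivAt_driftCurve t).continuousAt

/-! ### Inner products of the source and the volatility with 1, Z, Z² and Y -/

lemma inner_one_fst (h : IsGaussianPart p K Z Y) (t : ℝ) :
    ⟪Lp.const 2 P (1 : ℝ), Z t⟫_ℝ = 0 := by
  rw [inner_const_one_left, h.isGaussianSubspace.integral_eq_zero (h.fst_mem t)]

lemma inner_one_snd (h : IsGaussianPart p K Z Y) (t : ℝ) :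
    ⟪Lp.const 2 P (1 : ℝ), Y t⟫_ℝ = 0 := by
  rw [inner_const_one_left, h.isGaussianSubspace.integral_eq_zero (h.snd_mem t)]

lemma inner_one_sq (h : IsGaussianPart p K Z Y) {t : ℝ} (ht : 0 ≤ t) :
    ⟪Lp.const 2 P (1 : ℝ), sqLp (Z t)⟫_ℝ = p.varS t := by
  rw [inner_const_one_left, h.isGaussianSubspace.integral_sqLp (h.fst_mem t), h.norm_fst_sq ht]

lemma inner_source_one (h : IsGaussianPart p K Z Y) {u : ℝ} (hu : 0 ≤ u) :
    ⟪p.sourceCurve Z u, Lp.const 2 P (1 : ℝ)⟫_ℝ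
      = p.muV + p.betaV * (p.mS2 u - 2 * p.muS * p.mS u + p.muS ^ 2) := by
  rw [real_inner_comm, SSVParams.sourceCurve]
  simp only [inner_add_right, real_inner_smul_right, inner_const_one_self, h.inner_one_fst,
    h.inner_one_sq hu, p.mS2_eq]
  ring

lemma inner_source_fst (h : IsGaussianPart p K Z Y) {u t : ℝ} (hu : 0 ≤ u) (hut : u ≤ t) :
    ⟪p.sourceCurve Z u, Z t⟫_ℝ
      = Real.exp (p.lamS * (u - t)) * (2 * p.betaV * (p.mS u - p.muS) * p.varS u) := by
  rw [SSVParams.sourceCurve]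
  simp only [inner_add_left, real_inner_smul_left, h.inner_one_fst, h.inner_fst_fst hu hut,
    h.isGaussianSubspace.inner_sqLp_left (h.fst_mem u) (h.fst_mem t)]
  ring

/-- Only the Z component of the source correlates with Y, as Y is orthogonal to constants and to
squares. The later time therefore enters only through an exponential factor. -/
lemma inner_source_snd (h : IsGaussianPart p K Z Y) {u t : ℝ} (hu : 0 ≤ u) (hut : u ≤ t) :
    ⟪p.sourceCurve Z u, Y t⟫_ℝ = Real.exp (p.gamV * (u - t)) * ⟪p.sourceCurve Z u, Y u⟫_ℝ := by
  rw [SSVParams.sourceCurve]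
  simp only [inner_add_left, real_inner_smul_left, h.inner_one_snd, h.inner_fst_snd hu hut,
    h.inner_fst_snd hu le_rfl,
    h.isGaussianSubspace.inner_sqLp_left (h.fst_mem u) (h.snd_mem _)]
  simp
  ring

/-- The Isserlis term 2⟪Z u, Z t⟫² produces the doubled exponent; the products of variances combine
with the constant part into Var(Z t) times the mean of the source. -/
lemma inner_source_sq (h : IsGaussianPart p K Z Y) {u t : ℝ} (hu : 0 ≤ u) (hut : u ≤ t) :
    ⟪p.sourceCurve Z u, sqLp (Z t)⟫_ℝ
      = p.varS t * (p.muV + p.betaV * (p.mS2 u - 2 * p.muS * p.mS u + p.muS ^ 2))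
        + Real.exp (2 * p.lamS * (u - t)) * (2 * p.betaV * p.varS u ^ 2) := by
  have hE : Real.exp (2 * p.lamS * (u - t)) = Real.exp (p.lamS * (u - t)) ^ 2 := by
    rw [← Real.exp_nat_mul]; congr 1; push_cast; ring
  rw [SSVParams.sourceCurve]
  simp only [inner_add_left, real_inner_smul_left, h.inner_one_sq (hu.trans hut),
    real_inner_comm (sqLp (Z t)) (Z u),
    h.isGaussianSubspace.inner_sqLp_left (h.fst_mem t) (h.fst_mem u),
    h.isGaussianSubspace.inner_sqLp_sqLp (h.fst_mem u) (h.fst_mem t), h.inner_fst_fst hu hut,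
    h.norm_fst_sq hu, h.norm_fst_sq (hu.trans hut), p.mS2_eq, hE]
  ring

lemma inner_driftCurve (h : IsGaussianPart p K Z Y) (x : Lp ℝ 2 P) (t : ℝ) :
    ⟪p.driftCurve Z t, x⟫_ℝ = Real.exp (-p.gamV * t) * (p.V0 * ⟪Lp.const 2 P (1 : ℝ), x⟫_ℝ)
      + ∫ u in (0 : ℝ)..t, Real.exp (p.gamV * (u - t)) * ⟪p.sourceCurve Z u, x⟫_ℝ := by
  have := h.continuous_sourceCurve
  rw [SSVParams.driftCurve, inner_add_left, inner_intervalIntegral_left (by fun_prop)]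
  simp_rw [real_inner_smul_left]

/-- `E[V] = mV`. -/
lemma inner_vol_one (h : IsGaussianPart p K Z Y) {t : ℝ} (ht : 0 ≤ t) :
    ⟪p.volCurve Z Y t, Lp.const 2 P (1 : ℝ)⟫_ℝ = p.mV t := by
  rw [SSVParams.volCurve, inner_add_left, h.inner_driftCurve, inner_const_one_self,
    real_inner_comm, h.inner_one_snd, add_zero, mul_one, SSVParams.mV]
  congr 1
  refine intervalIntegral.integral_congr fun u hu => ?_
  rw [Set.uIcc_of_le ht] at hu
  simp only [h.inner_source_one hu.1]

lemma inner_vol_fst (h : IsGaussianPart p K Z Y) {t : ℝ} (ht : 0 ≤ t) :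
    ⟪p.volCurve Z Y t, Z t⟫_ℝ = p.covSV t := by
  have h1 := p.continuous_mS
  have h2 := p.continuous_varS
  have hint : ∫ u in (0 : ℝ)..t, Real.exp (p.gamV * (u - t)) * ⟪p.sourceCurve Z u, Z t⟫_ℝ
      = ∫ u in (0 : ℝ)..t, Real.exp ((p.gamV + p.lamS) * (u - t))
        * (2 * p.betaV * (p.mS u - p.muS) * p.varS u) := by
    refine intervalIntegral.integral_congr fun u hu => ?_
    rw [Set.uIcc_of_le ht] at hu
    simp only [h.inner_source_fst hu.1 hu.2]
    rw [add_mul, Real.exp_add]; ring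
  rw [SSVParams.volCurve, inner_add_left, h.inner_driftCurve, h.inner_one_fst,
    real_inner_comm (Z t) (Y t), h.inner_fst_snd ht le_rfl, hint, SSVParams.covSV]
  simp_rw [mul_add]
  rw [intervalIntegral.integral_add (Continuous.intervalIntegrable (by fun_prop) _ _)
    (Continuous.intervalIntegrable (by fun_prop) _ _), intervalIntegral.integral_mul_const,
    add_comm p.lamS p.gamV]
  simp
  ring

lemma inner_vol_sq (h : IsGaussianPart p K Z Y) {t : ℝ} (ht : 0 ≤ t) :
    ⟪p.volCurve Z Y t, sqLp (Z t)⟫_ℝ = p.varS t * p.mV t + p.covSqV t := by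
  have h1 := p.continuous_mS
  have h2 := p.continuous_varS
  have h3 := p.continuous_mS2
  have hint : ∫ u in (0 : ℝ)..t, Real.exp (p.gamV * (u - t)) * ⟪p.sourceCurve Z u, sqLp (Z t)⟫_ℝ
      = p.varS t * (∫ u in (0 : ℝ)..t, Real.exp (p.gamV * (u - t))
          * (p.muV + p.betaV * (p.mS2 u - 2 * p.muS * p.mS u + p.muS ^ 2))) + p.covSqV t := by
    rw [SSVParams.covSqV, ← intervalIntegral.integral_const_mul,
      ← intervalIntegral.integral_add (Continuous.intervalIntegrable (by fun_prop) _ _)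
      (Continuous.intervalIntegrable (by fun_prop) _ _)]
    refine intervalIntegral.integral_congr fun u hu => ?_
    rw [Set.uIcc_of_le ht] at hu
    simp only [h.inner_source_sq hu.1 hu.2]
    rw [add_mul, Real.exp_add]; ring
  rw [SSVParams.volCurve, inner_add_left, h.inner_driftCurve, h.inner_one_sq ht,
    real_inner_comm (sqLp (Z t)) (Y t),
    h.isGaussianSubspace.inner_sqLp_left (h.fst_mem t) (h.snd_mem t), hint, SSVParams.mV]
  ring

lemma inner_source_vol (h : IsGaussianPart p K Z Y) {t : ℝ} (ht : 0 ≤ t) :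
    ⟪p.sourceCurve Z t, p.volCurve Z Y t⟫_ℝ
      = (p.muV + p.betaV * (p.mS t - p.muS) ^ 2) * p.mV t
        + 2 * p.betaV * (p.mS t - p.muS) * p.covSV t
        + p.betaV * (p.varS t * p.mV t + p.covSqV t) := by
  rw [real_inner_comm, SSVParams.sourceCurve]
  simp only [inner_add_right, real_inner_smul_right, h.inner_vol_one ht, h.inner_vol_fst ht,
    h.inner_vol_sq ht]

lemma inner_vol_vol (h : IsGaussianPart p K Z Y) (hlam : p.lamS ≠ 0) {t : ℝ} (ht : 0 ≤ t) :
    ⟪p.volCurve Z Y t, p.volCurve Z Y t⟫_ℝ = p.mV2 t := by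
  have hq := h.continuous_sourceCurve
  have hD := h.continuous_driftCurve
  have hY := h.continuous_snd
  have hV : Continuous (p.volCurve Z Y) := hD.add hY
  -- Y has no derivative in L², so ‖D + Y‖² cannot be differentiated termwise. For t ≥ 0 the terms
  -- 2⟪D, Y⟫ + ‖Y‖² equal an exponential convolution, which makes `g` differentiable on all of ℝ.
  set g : ℝ → ℝ := fun t => ⟪p.driftCurve Z t, p.driftCurve Z t⟫_ℝ
    + ∫ u in (0 : ℝ)..t, Real.exp (2 * p.gamV * (u - t))
      * (2 * ⟪p.sourceCurve Z u, Y u⟫_ℝ + p.sigV ^ 2) with hg_def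
  have hg : ∀ t, HasDerivAt g (-((2 * p.gamV) • g t)
      + (2 * ⟪p.sourceCurve Z t, p.volCurve Z Y t⟫_ℝ + p.sigV ^ 2)) t := by
    intro t
    have hconv := hasDerivAt_expConvolution (2 * p.gamV)
      (f := fun u => 2 * ⟪p.sourceCurve Z u, Y u⟫_ℝ + p.sigV ^ 2) (by fun_prop) t
    refine (((h.hasDerivAt_driftCurve t).inner ℝ (h.hasDerivAt_driftCurve t)).add
      hconv).congr_deriv ?_
    simp only [hg_def, SSVParams.volCurve, inner_add_left, inner_add_right, inner_neg_left,
      inner_neg_right, real_inner_smul_left, real_inner_smul_right, smul_eq_mul,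
      real_inner_comm (p.sourceCurve Z t) (p.driftCurve Z t)]
    ring
  have hgV : ⟪p.volCurve Z Y t, p.volCurve Z Y t⟫_ℝ = g t := by
    have hDY : ⟪p.driftCurve Z t, Y t⟫_ℝ
        = ∫ u in (0 : ℝ)..t, Real.exp (2 * p.gamV * (u - t)) * ⟪p.sourceCurve Z u, Y u⟫_ℝ := by
      rw [h.inner_driftCurve, h.inner_one_snd, mul_zero, mul_zero, zero_add]
      refine intervalIntegral.integral_congr fun u hu => ?_
      rw [Set.uIcc_of_le ht] at hu
      simp only [h.inner_source_snd hu.1 hu.2]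
      rw [mul_assoc, two_mul, Real.exp_add]; ring
    have hsplit : ∫ u in (0 : ℝ)..t, Real.exp (2 * p.gamV * (u - t))
        * (2 * ⟪p.sourceCurve Z u, Y u⟫_ℝ + p.sigV ^ 2)
        = 2 * (∫ u in (0 : ℝ)..t, Real.exp (2 * p.gamV * (u - t)) * ⟪p.sourceCurve Z u, Y u⟫_ℝ)
          + p.sigV ^ 2 * ∫ u in (0 : ℝ)..t, Real.exp (2 * p.gamV * (u - t)) := by
      rw [← intervalIntegral.integral_const_mul, ← intervalIntegral.integral_const_mul,
        ← intervalIntegral.integral_add (Continuous.intervalIntegrable (by fun_prop) _ _)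
        (Continuous.intervalIntegrable (by fun_prop) _ _)]
      congr 1; ext u; ring
    simp only [hg_def]
    rw [SSVParams.volCurve, inner_add_left, inner_add_right, inner_add_right,
      real_inner_comm (p.driftCurve Z t) (Y t), hDY, h.inner_snd_snd ht, hsplit]
    ring
  have hg0 : g 0 = p.V0 ^ 2 := by
    simp only [hg_def, SSVParams.driftCurve, intervalIntegral.integral_same, add_zero, mul_zero,
      Real.exp_zero, one_smul, real_inner_smul_left, real_inner_smul_right, inner_const_one_self]
    ring
  rw [hgV, eq_variationOfConstants (a := 2 * p.gamV) (g := g) (by fun_prop) hg t, hg0,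
    SSVParams.mV2, smul_eq_mul, show -(2 * p.gamV) * t = -2 * p.gamV * t by ring]
  congr 1
  refine intervalIntegral.integral_congr fun u hu => ?_
  rw [Set.uIcc_of_le ht] at hu
  simp only [h.inner_source_vol hu.1, p.mSV_eq, p.mS2V_eq hlam, p.mS2_eq, smul_eq_mul]
  ring

end IsGaussianPart

end SolutionCurve

/-! ### Moments of the solution -/

section Moments

open scoped InnerProductSpace

variable {Ω : Type*} [MeasurableSpace Ω] {P : Measure Ω}

namespace IsGaussianSubspace

variable {K : Submodule ℝ (Lp ℝ 2 P)} {x : Lp ℝ 2 P}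

lemma integrable_pow (hK : IsGaussianSubspace K) (hx : x ∈ K) (n : ℕ) :
    Integrable (fun ω => x ω ^ n) P := by
  have := (hK x hx).hasGaussianLaw.isProbabilityMeasure
  have hn : MemLp x (n : ℕ) P := hK.memLp hx (by simp)
  refine (integrable_norm_iff ((Lp.aestronglyMeasurable x).pow n)).1
    (hn.integrable_norm_pow'.congr (ae_of_all _ fun ω => ?_))
  simp

lemma integral_const_add (hK : IsGaussianSubspace K) (hx : x ∈ K) (m : ℝ) :
    ∫ ω, (m + x ω) ∂P = m := by
  have := (hK x hx).hasGaussianLaw.isProbabilityMeasure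
  rw [integral_add (integrable_const m) (hK x hx).hasGaussianLaw.integrable,
    hK.integral_eq_zero hx]
  simp

lemma integral_const_add_pow_two (hK : IsGaussianSubspace K) (hx : x ∈ K) (m : ℝ) :
    ∫ ω, (m + x ω) ^ 2 ∂P = ‖x‖ ^ 2 + m ^ 2 := by
  have := (hK x hx).hasGaussianLaw.isProbabilityMeasure
  have h1 := (hK.integrable_pow hx 1).const_mul (2 * m)
  have h2 := hK.integrable_pow hx 2
  have he : ∀ ω, (m + x ω) ^ 2 = m ^ 2 + (2 * m * x ω ^ 1 + x ω ^ 2) := fun ω => by ring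
  simp_rw [he]
  rw [integral_add (integrable_const _) (h1.fun_add h2), integral_add h1 h2, integral_const_mul,
    hK.integral_pow_two hx]
  simp [hK.integral_eq_zero hx]
  ring

lemma integral_const_add_pow_three (hK : IsGaussianSubspace K) (hx : x ∈ K) (m : ℝ) :
    ∫ ω, (m + x ω) ^ 3 ∂P = m ^ 3 + 3 * m * ‖x‖ ^ 2 := by
  have := (hK x hx).hasGaussianLaw.isProbabilityMeasure
  have h1 := (hK.integrable_pow hx 1).const_mul (3 * m ^ 2)
  have h2 := (hK.integrable_pow hx 2).const_mul (3 * m)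
  have h3 := hK.integrable_pow hx 3
  have he : ∀ ω, (m + x ω) ^ 3
      = m ^ 3 + (3 * m ^ 2 * x ω ^ 1 + (3 * m * x ω ^ 2 + x ω ^ 3)) := fun ω => by ring
  simp_rw [he]
  rw [integral_add (integrable_const _) (h1.fun_add (h2.fun_add h3)),
    integral_add h1 (h2.fun_add h3), integral_add h2 h3, integral_const_mul, integral_const_mul,
    hK.integral_pow_two hx, hK.integral_pow_three hx]
  simp [hK.integral_eq_zero hx]

lemma integral_const_add_pow_four (hK : IsGaussianSubspace K) (hx : x ∈ K) (m : ℝ) :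
    ∫ ω, (m + x ω) ^ 4 ∂P = m ^ 4 + 6 * m ^ 2 * ‖x‖ ^ 2 + 3 * (‖x‖ ^ 2) ^ 2 := by
  have := (hK x hx).hasGaussianLaw.isProbabilityMeasure
  have h1 := (hK.integrable_pow hx 1).const_mul (4 * m ^ 3)
  have h2 := (hK.integrable_pow hx 2).const_mul (6 * m ^ 2)
  have h3 := (hK.integrable_pow hx 3).const_mul (4 * m)
  have h4 := hK.integrable_pow hx 4
  have he : ∀ ω, (m + x ω) ^ 4
      = m ^ 4 + (4 * m ^ 3 * x ω ^ 1 + (6 * m ^ 2 * x ω ^ 2 + (4 * m * x ω ^ 3 + x ω ^ 4))) :=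
    fun ω => by ring
  simp_rw [he]
  rw [integral_add (integrable_const _) (h1.fun_add (h2.fun_add (h3.fun_add h4))),
    integral_add h1 (h2.fun_add (h3.fun_add h4)), integral_add h2 (h3.fun_add h4),
    integral_add h3 h4, integral_const_mul, integral_const_mul, integral_const_mul,
    hK.integral_pow_two hx, hK.integral_pow_three hx, hK.integral_pow_four hx]
  simp [hK.integral_eq_zero hx]
  ring

end IsGaussianSubspace

/-- This links the abstract curve to the noise term obtained by solving the equations pathwise. -/
lemma coeFn_ouCurve_brownianCurve [IsProbabilityMeasure P] {W : ℝ≥0 → Ω → ℝ}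
    (hW : IsBrownianReal W P) (a : ℝ) {t : ℝ} (ht : 0 ≤ t) :
    (ouCurve a (brownianCurve hW.toIsPreBrownianReal) t : Lp ℝ 2 P) =ᵐ[P] fun ω =>
      W t.toNNReal ω - a * ∫ u in (0 : ℝ)..t, Real.exp (a * (u - t)) * W u.toNNReal ω := by
  have hB := continuous_brownianCurve hW.toIsPreBrownianReal
  have hint := intervalIntegral_ae_eq_Lp (P := P)
    (X := fun u ω => Real.exp (a * (u - t)) * W u.toNNReal ω)
    (F := fun u => Real.exp (a * (u - t)) • brownianCurve hW.toIsPreBrownianReal u) (by fun_prop)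
    (fun u _ => by
      filter_upwards [Lp.coeFn_smul (Real.exp (a * (u - t)))
        (brownianCurve hW.toIsPreBrownianReal u),
        coeFn_brownianCurve hW.toIsPreBrownianReal u] with ω h1 h2
      simp [h1, h2])
    (by
      filter_upwards [hW.cont] with ω hω
      have : Continuous fun u : ℝ => W u.toNNReal ω := hω.comp continuous_real_toNNReal
      fun_prop) ht
  rw [ouCurve]
  filter_upwards [Lp.coeFn_sub (brownianCurve hW.toIsPreBrownianReal t) (a • ∫ u in (0 : ℝ)..t,
      Real.exp (a * (u - t)) • brownianCurve hW.toIsPreBrownianReal u),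
    Lp.coeFn_smul a (∫ u in (0 : ℝ)..t,
      Real.exp (a * (u - t)) • brownianCurve hW.toIsPreBrownianReal u), hint,
    coeFn_brownianCurve hW.toIsPreBrownianReal t] with ω h1 h2 h3 h4
  rw [h1, Pi.sub_apply, h2, Pi.smul_apply, ← h3, h4, smul_eq_mul]

namespace IsSSVSolution

variable {p : SSVParams} {Ws Wv S V : ℝ≥0 → Ω → ℝ}

/-- The centred Ornstein–Uhlenbeck part of the sentiment. -/
def sentimentCurve (hSV : IsSSVSolution p Ws Wv S V P) (t : ℝ) : Lp ℝ 2 P :=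
  p.sigS • ouCurve p.lamS (brownianCurve hSV.noise.fst.toIsPreBrownianReal) t

/-- The Ornstein–Uhlenbeck part of the volatility driven by its own noise. -/
def noiseCurve (hSV : IsSSVSolution p Ws Wv S V P) (t : ℝ) : Lp ℝ 2 P :=
  p.sigV • ouCurve p.gamV (brownianCurve hSV.noise.snd.toIsPreBrownianReal) t

lemma exists_isGaussianPart [IsProbabilityMeasure P] (hSV : IsSSVSolution p Ws Wv S V P)
    (hlam : p.lamS ≠ 0) :
    ∃ K, IsGaussianPart p K hSV.sentimentCurve hSV.noiseCurve := by
  obtain ⟨K, hK, hKc, h1, h2⟩ := hSV.noise.exists_isGaussianSubspace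
  have hBs := continuous_brownianCurve hSV.noise.fst.toIsPreBrownianReal
  have hBv := continuous_brownianCurve hSV.noise.snd.toIsPreBrownianReal
  have hss : ∀ s t, 0 ≤ s → 0 ≤ t → ⟪brownianCurve hSV.noise.fst.toIsPreBrownianReal s,
      brownianCurve hSV.noise.fst.toIsPreBrownianReal t⟫_ℝ = 1 * min s t := by
    intro s t hs ht
    rw [inner_brownianCurve, hSV.noise.fst.covariance_eval]
    simp [hs, ht]
  have hvv : ∀ s t, 0 ≤ s → 0 ≤ t → ⟪brownianCurve hSV.noise.snd.toIsPreBrownianReal s,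
      brownianCurve hSV.noise.snd.toIsPreBrownianReal t⟫_ℝ = 1 * min s t := by
    intro s t hs ht
    rw [inner_brownianCurve, hSV.noise.snd.covariance_eval]
    simp [hs, ht]
  have hsv : ∀ s t, 0 ≤ s → 0 ≤ t → ⟪brownianCurve hSV.noise.fst.toIsPreBrownianReal s,
      brownianCurve hSV.noise.snd.toIsPreBrownianReal t⟫_ℝ = p.rhoSV * min s t := by
    intro s t hs ht
    rw [inner_brownianCurve, hSV.noise.covariance_eval]
    simp [hs, ht]
  refine ⟨K, hK, (continuous_ouCurve p.lamS hBs).const_smul p.sigS,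
    (continuous_ouCurve p.gamV hBv).const_smul p.sigV,
    fun t => K.smul_mem _ (ouCurve_mem hKc _ hBs h1 t),
    fun t => K.smul_mem _ (ouCurve_mem hKc _ hBv h2 t), ?_, ?_, ?_⟩
  · intro s t hs hst
    rw [sentimentCurve, sentimentCurve, real_inner_smul_left, real_inner_smul_right,
      inner_ouCurve_ouCurve hBs hBs hss _ _ hs hst, p.varS_eq hlam, two_mul]
    ring
  · intro s t hs hst
    rw [sentimentCurve, noiseCurve, real_inner_smul_left, real_inner_smul_right,
      inner_ouCurve_ouCurve hBs hBv hsv _ _ hs hst]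
    ring
  · intro t ht
    rw [noiseCurve, real_inner_smul_left, real_inner_smul_right,
      inner_ouCurve_ouCurve hBv hBv hvv _ _ ht le_rfl, two_mul]
    simp
    ring

variable [IsProbabilityMeasure P]

lemma ae_eq_sentiment (hSV : IsSSVSolution p Ws Wv S V P) {t : ℝ} (ht : 0 ≤ t) :
    S t.toNNReal =ᵐ[P] fun ω => p.mS t + hSV.sentimentCurve t ω := by
  filter_upwards [hSV.continuous_S, hSV.eq_S, coeFn_ouCurve_brownianCurve hSV.noise.fst p.lamS ht,
    Lp.coeFn_smul p.sigS (ouCurve p.lamS (brownianCurve hSV.noise.fst.toIsPreBrownianReal) t)]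
    with ω hc heq hou hsm
  have hS : Continuous fun u : ℝ => S u.toNNReal ω := hc.comp continuous_real_toNNReal
  have := eq_of_linear_integral_equation (a := p.lamS) (x₀ := p.S0)
    (f := fun _ => p.lamS * p.muS) (x := fun u => S u.toNNReal ω)
    (w := fun u => p.sigS * Ws u.toNNReal ω) continuous_const hS (fun s hs => by
      have h := heq s.toNNReal
      rw [Real.coe_toNNReal s hs] at h
      rw [h]
      simp_rw [mul_sub]) ht
  rw [this, sentimentCurve, hsm, Pi.smul_apply, hou, SSVParams.mS,
    ← integral_exp_mul_eq p.lamS t, intervalIntegral.integral_mul_const]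
  simp_rw [mul_left_comm _ p.sigS]
  rw [intervalIntegral.integral_const_mul, smul_eq_mul]
  ring

lemma ae_eq_volatility (hSV : IsSSVSolution p Ws Wv S V P) (hlam : p.lamS ≠ 0) {t : ℝ}
    (ht : 0 ≤ t) :
    V t.toNNReal =ᵐ[P] p.volCurve hSV.sentimentCurve hSV.noiseCurve t := by
  obtain ⟨K, hK⟩ := hSV.exists_isGaussianPart hlam
  have hq := hK.continuous_sourceCurve
  have hsource : ∀ u, 0 ≤ u →
      (fun ω => p.muV + p.betaV * (S u.toNNReal ω - p.muS) ^ 2)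
        =ᵐ[P] p.sourceCurve hSV.sentimentCurve u := by
    intro u hu
    rw [SSVParams.sourceCurve]
    filter_upwards [hSV.ae_eq_sentiment hu,
      hK.isGaussianSubspace.coeFn_sqLp (hK.fst_mem u),
      Lp.coeFn_const (p := 2) (μ := P) (1 : ℝ),
      Lp.coeFn_smul (p.muV + p.betaV * (p.mS u - p.muS) ^ 2) (Lp.const 2 P (1 : ℝ)),
      Lp.coeFn_smul (2 * p.betaV * (p.mS u - p.muS)) (hSV.sentimentCurve u),
      Lp.coeFn_smul p.betaV (sqLp (hSV.sentimentCurve u)),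
      Lp.coeFn_add ((p.muV + p.betaV * (p.mS u - p.muS) ^ 2) • Lp.const 2 P (1 : ℝ))
        ((2 * p.betaV * (p.mS u - p.muS)) • hSV.sentimentCurve u),
      Lp.coeFn_add ((p.muV + p.betaV * (p.mS u - p.muS) ^ 2) • Lp.const 2 P (1 : ℝ)
        + (2 * p.betaV * (p.mS u - p.muS)) • hSV.sentimentCurve u)
        (p.betaV • sqLp (hSV.sentimentCurve u))] with ω h1 h2 h3 h4 h5 h6 h7 h8
    rw [h8, Pi.add_apply, h7, Pi.add_apply, h4, h5, h6]
    simp only [Pi.smul_apply, h1, h2, h3, Function.const_apply, smul_eq_mul]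
    ring
  have hint := intervalIntegral_ae_eq_Lp (P := P)
    (X := fun u ω => Real.exp (p.gamV * (u - t))
      * (p.muV + p.betaV * (S u.toNNReal ω - p.muS) ^ 2))
    (F := fun u => Real.exp (p.gamV * (u - t)) • p.sourceCurve hSV.sentimentCurve u) (by fun_prop)
    (fun u hu => by
      filter_upwards [Lp.coeFn_smul (Real.exp (p.gamV * (u - t)))
        (p.sourceCurve hSV.sentimentCurve u), hsource u hu] with ω h1 h2
      rw [h1, Pi.smul_apply, ← h2, smul_eq_mul])
    (by
      filter_upwards [hSV.continuous_S] with ω hω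
      have : Continuous fun u : ℝ => S u.toNNReal ω := hω.comp continuous_real_toNNReal
      fun_prop) ht
  rw [SSVParams.volCurve, SSVParams.driftCurve, smul_smul]
  filter_upwards [hSV.continuous_S, hSV.continuous_V, hSV.eq_V,
    coeFn_ouCurve_brownianCurve hSV.noise.snd p.gamV ht,
    Lp.coeFn_smul p.sigV (ouCurve p.gamV (brownianCurve hSV.noise.snd.toIsPreBrownianReal) t),
    hint, Lp.coeFn_const (p := 2) (μ := P) (1 : ℝ),
    Lp.coeFn_smul (Real.exp (-p.gamV * t) * p.V0) (Lp.const 2 P (1 : ℝ)),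
    Lp.coeFn_add ((Real.exp (-p.gamV * t) * p.V0) • Lp.const 2 P (1 : ℝ))
      (∫ u in (0 : ℝ)..t, Real.exp (p.gamV * (u - t)) • p.sourceCurve hSV.sentimentCurve u),
    Lp.coeFn_add ((Real.exp (-p.gamV * t) * p.V0) • Lp.const 2 P (1 : ℝ)
      + ∫ u in (0 : ℝ)..t, Real.exp (p.gamV * (u - t)) • p.sourceCurve hSV.sentimentCurve u)
      (hSV.noiseCurve t)]
    with ω hcS hcV heq hou hsm hi h1 h2 h3 h4
  have hS : Continuous fun u : ℝ => S u.toNNReal ω := hcS.comp continuous_real_toNNReal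
  have hV : Continuous fun u : ℝ => V u.toNNReal ω := hcV.comp continuous_real_toNNReal
  have := eq_of_linear_integral_equation (a := p.gamV) (x₀ := p.V0)
    (f := fun u => p.muV + p.betaV * (S u.toNNReal ω - p.muS) ^ 2) (x := fun u => V u.toNNReal ω)
    (w := fun u => p.sigV * Wv u.toNNReal ω) (by fun_prop) hV (fun s hs => by
      have h := heq s.toNNReal
      rw [Real.coe_toNNReal s hs] at h
      exact h) ht
  rw [h4, Pi.add_apply, h3, Pi.add_apply, h2, Pi.smul_apply, h1, ← hi, noiseCurve, hsm,
    Pi.smul_apply, hou, this, Function.const_apply]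
  simp_rw [mul_left_comm _ p.sigV]
  rw [intervalIntegral.integral_const_mul, smul_eq_mul, smul_eq_mul]
  ring

lemma exists_curves (hSV : IsSSVSolution p Ws Wv S V P) (hlam : p.lamS ≠ 0) :
    ∃ (K : Submodule ℝ (Lp ℝ 2 P)) (Z Y : ℝ → Lp ℝ 2 P), IsGaussianPart p K Z Y ∧
      ∀ t : ℝ≥0, (S t =ᵐ[P] fun ω => p.mS t + Z t ω) ∧ V t =ᵐ[P] p.volCurve Z Y t := by
  obtain ⟨K, hK⟩ := hSV.exists_isGaussianPart hlam
  refine ⟨K, _, _, hK, fun t => ⟨?_, ?_⟩⟩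
  · simpa using hSV.ae_eq_sentiment t.2
  · simpa using hSV.ae_eq_volatility hlam t.2

end IsSSVSolution

/-! ### Positivity of the variance of the volatility -/

namespace IsGaussianPart

variable [IsProbabilityMeasure P] {p : SSVParams} {K : Submodule ℝ (Lp ℝ 2 P)}
  {Z Y : ℝ → Lp ℝ 2 P}

/-- The volatility is not deterministic at positive times. -/
lemma volCurve_ne_const (h : IsGaussianPart p K Z Y) (hlam : p.lamS ≠ 0) (hsig : p.sigS ≠ 0)
    (hne : p.sigV ≠ 0 ∨ p.betaV ≠ 0) {t : ℝ} (ht : 0 < t) (c : ℝ) :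
    p.volCurve Z Y t ≠ c • Lp.const 2 P (1 : ℝ) := by
  intro hV
  have h1 := h.inner_vol_one ht.le
  rw [hV, real_inner_smul_left, inner_const_one_self, mul_one] at h1
  subst h1
  -- Without the quadratic loading, V correlates with its own noise part Y; with it, V correlates
  -- with Z² through `covSqV`. A constant does neither, since Y and Z² - E[Z²] are centred.
  by_cases hbeta : p.betaV = 0
  · have hsigV : p.sigV ≠ 0 := hne.resolve_right (not_not.2 hbeta)
    have h2 : ⟪p.volCurve Z Y t, Y t⟫_ℝ
        = p.sigV ^ 2 * ∫ u in (0 : ℝ)..t, Real.exp (2 * p.gamV * (u - t)) := by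
      rw [SSVParams.volCurve, inner_add_left, h.inner_driftCurve, h.inner_one_snd,
        h.inner_snd_snd ht.le]
      simp [SSVParams.sourceCurve, hbeta, real_inner_smul_left, h.inner_one_snd]
    rw [hV, real_inner_smul_left, h.inner_one_snd, mul_zero] at h2
    have : 0 < ∫ u in (0 : ℝ)..t, Real.exp (2 * p.gamV * (u - t)) :=
      intervalIntegral.intervalIntegral_pos_of_pos
        (Continuous.intervalIntegrable (by fun_prop) _ _) (fun _ => Real.exp_pos _) ht
    have : 0 < p.sigV ^ 2 * ∫ u in (0 : ℝ)..t, Real.exp (2 * p.gamV * (u - t)) := by positivity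
    linarith
  · have h2 := h.inner_vol_sq ht.le
    rw [hV, real_inner_smul_left, h.inner_one_sq ht.le] at h2
    exact p.covSqV_ne_zero hlam hsig hbeta ht (by linarith)

/-- The difference is the squared L² distance from V to its mean. -/
lemma mV2_sub_pos (h : IsGaussianPart p K Z Y) (hlam : p.lamS ≠ 0) (hsig : p.sigS ≠ 0)
    (hne : p.sigV ≠ 0 ∨ p.betaV ≠ 0) {t : ℝ} (ht : 0 < t) : 0 < p.mV2 t - p.mV t ^ 2 := by
  have hpos : 0 < ‖p.volCurve Z Y t - p.mV t • Lp.const 2 P (1 : ℝ)‖ ^ 2 := by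
    have := norm_pos_iff.2 (sub_ne_zero.2 (h.volCurve_ne_const hlam hsig hne ht (p.mV t)))
    positivity
  rw [norm_sub_sq_real, ← real_inner_self_eq_norm_sq, ← real_inner_self_eq_norm_sq,
    h.inner_vol_vol hlam ht.le, real_inner_smul_right, real_inner_smul_right, real_inner_smul_left,
    h.inner_vol_one ht.le, inner_const_one_self] at hpos
  linarith

end IsGaussianPart

end Moments

end

theorem theorem2 {Ω : Type*} [MeasurableSpace Ω] (P : Measure Ω) [IsProbabilityMeasure P]
    (p : SSVParams) (hlam : p.lamS ≠ 0)
    (Ws Wv S V : ℝ≥0 → Ω → ℝ) (hSV : IsSSVSolution p Ws Wv S V P) :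
    (∀ t : ℝ≥0,
      MemLp (S t) 4 P ∧ MemLp (V t) 2 P ∧
      (∫ ω, S t ω ∂P) = p.mS t ∧
      (∫ ω, S t ω ^ 2 ∂P) = p.mS2 t ∧
      (∫ ω, S t ω ^ 3 ∂P) = p.mS3 t ∧
      (∫ ω, S t ω ^ 4 ∂P) = p.mS4 t ∧
      (∫ ω, V t ω ∂P) = p.mV t ∧
      (∫ ω, S t ω * V t ω ∂P) = p.mSV t ∧
      (∫ ω, S t ω ^ 2 * V t ω ∂P) = p.mS2V t ∧
      (∫ ω, V t ω ^ 2 ∂P) = p.mV2 t) ∧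
    (∀ t : ℝ≥0, 0 < t → p.sigS ≠ 0 → (p.sigV ≠ 0 ∨ p.betaV ≠ 0) →
      0 < Var[S t; P] ∧ 0 < Var[V t; P] ∧
      correlation (S t) (V t) P =
        ((∫ ω, S t ω * V t ω ∂P) - (∫ ω, S t ω ∂P) * (∫ ω, V t ω ∂P)) /
          (√((∫ ω, S t ω ^ 2 ∂P) - (∫ ω, S t ω ∂P) ^ 2) *
            √((∫ ω, V t ω ^ 2 ∂P) - (∫ ω, V t ω ∂P) ^ 2)) ∧
      correlation (S t) (V t) P =
        (p.mSV t - p.mS t * p.mV t) /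
          (√(p.mS2 t - p.mS t ^ 2) * √(p.mV2 t - p.mV t ^ 2))) := by
  obtain ⟨K, Z, Y, hG, hae⟩ := hSV.exists_curves hlam
  have hK := hG.isGaussianSubspace
  have hmom : ∀ t : ℝ≥0,
      MemLp (S t) 4 P ∧ MemLp (V t) 2 P ∧
      (∫ ω, S t ω ∂P) = p.mS t ∧
      (∫ ω, S t ω ^ 2 ∂P) = p.mS2 t ∧
      (∫ ω, S t ω ^ 3 ∂P) = p.mS3 t ∧
      (∫ ω, S t ω ^ 4 ∂P) = p.mS4 t ∧
      (∫ ω, V t ω ∂P) = p.mV t ∧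
      (∫ ω, S t ω * V t ω ∂P) = p.mSV t ∧
      (∫ ω, S t ω ^ 2 * V t ω ∂P) = p.mS2V t ∧
      (∫ ω, V t ω ^ 2 ∂P) = p.mV2 t := by
    intro t
    have ht : (0 : ℝ) ≤ t := t.2
    obtain ⟨hS, hV⟩ := hae t
    set v : Lp ℝ 2 P := p.volCurve Z Y t with hv_def
    have hZK : Z t ∈ K := hG.fst_mem t
    have hnorm := hG.norm_fst_sq ht
    have hEV : ∫ ω, v ω ∂P = p.mV t := by rw [← inner_const_one_right, hG.inner_vol_one ht]
    have hEZV : ∫ ω, Z t ω * v ω ∂P = p.covSV t := by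
      rw [← inner_Lp_eq_integral_mul, real_inner_comm, hG.inner_vol_fst ht]
    have hsqv : (fun ω => sqLp (Z t) ω * v ω) =ᵐ[P] fun ω => Z t ω ^ 2 * v ω := by
      filter_upwards [hK.coeFn_sqLp hZK] with ω h
      rw [h]
    have hEZ2V : ∫ ω, Z t ω ^ 2 * v ω ∂P = p.varS t * p.mV t + p.covSqV t := by
      rw [← hG.inner_vol_sq ht, real_inner_comm, inner_Lp_eq_integral_mul, integral_congr_ae hsqv]
    have hiv : Integrable v P := (Lp.memLp v).integrable (by norm_num)
    have hizv := integrable_mul_Lp (Z t) v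
    have hiz2v : Integrable (fun ω => Z t ω ^ 2 * v ω) P :=
      (integrable_mul_Lp (sqLp (Z t)) v).congr hsqv
    have hSpow : ∀ n : ℕ, ∫ ω, S t ω ^ n ∂P = ∫ ω, (p.mS t + Z t ω) ^ n ∂P := fun n =>
      integral_congr_ae (hS.mono fun ω h => by simp only [h])
    have hZ4 : MemLp (fun ω => Z t ω) 4 P := hK.memLp hZK (by simp)
    have hS4 : MemLp (fun ω => p.mS t + Z t ω) 4 P := MemLp.add (memLp_const (p.mS t)) hZ4
    refine ⟨?_, (memLp_congr_ae hV).2 (Lp.memLp v), ?_, ?_, ?_, ?_, ?_, ?_, ?_, ?_⟩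
    · exact (memLp_congr_ae hS).2 hS4
    · rw [integral_congr_ae hS, hK.integral_const_add hZK]
    · rw [hSpow, hK.integral_const_add_pow_two hZK, hnorm, p.mS2_eq]
    · rw [hSpow, hK.integral_const_add_pow_three hZK, hnorm, p.mS3_eq]
    · rw [hSpow, hK.integral_const_add_pow_four hZK, hnorm, p.mS4_eq]
    · rw [integral_congr_ae hV, hEV]
    · have he : (fun ω => S t ω * V t ω) =ᵐ[P] fun ω => p.mS t * v ω + Z t ω * v ω := by
        filter_upwards [hS, hV] with ω h1 h2
        rw [h1, h2]; ring
      rw [integral_congr_ae he, integral_add (hiv.const_mul _) hizv, integral_const_mul, hEV, hEZV,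
        p.mSV_eq]
    -- Expanding (`mS` + Z)² V leaves the three known expectations of V, ZV and Z²V.
    · have he : (fun ω => S t ω ^ 2 * V t ω)
          =ᵐ[P] fun ω => p.mS t ^ 2 * v ω + (2 * p.mS t * (Z t ω * v ω) + Z t ω ^ 2 * v ω) := by
        filter_upwards [hS, hV] with ω h1 h2
        rw [h1, h2]; ring
      rw [integral_congr_ae he, integral_add (hiv.const_mul _) ((hizv.const_mul _).fun_add hiz2v),
        integral_add (hizv.const_mul _) hiz2v, integral_const_mul, integral_const_mul, hEV, hEZV,
        hEZ2V, p.mS2V_eq hlam, p.mS2_eq]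
      ring
    · rw [integral_congr_ae (hV.mono fun ω h => by simp only [h] : _ =ᵐ[P] fun ω => v ω ^ 2),
        ← norm_sq_Lp_eq_integral_sq, ← real_inner_self_eq_norm_sq, hG.inner_vol_vol hlam ht]
  refine ⟨hmom, fun t ht hsig hne => ?_⟩
  obtain ⟨hS4, hV2, e1, e2, -, -, e5, e6, -, e8⟩ := hmom t
  have hS2 : MemLp (S t) 2 P := hS4.mono_exponent (by norm_num)
  have ht' : (0 : ℝ) < t := by exact_mod_cast ht
  have hvarS : Var[S t; P] = p.mS2 t - p.mS t ^ 2 := by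
    rw [variance_eq_sub hS2, ← e1, ← e2]; rfl
  have hvarV : Var[V t; P] = p.mV2 t - p.mV t ^ 2 := by
    rw [variance_eq_sub hV2, ← e5, ← e8]; rfl
  have hcov : cov[S t, V t; P] = p.mSV t - p.mS t * p.mV t := by
    rw [covariance_eq_sub hS2 hV2, ← e1, ← e5, ← e6]; rfl
  refine ⟨?_, ?_, ?_, ?_⟩
  · rw [hvarS, p.mS2_eq, add_sub_cancel_right]
    exact p.varS_pos hlam hsig ht'
  · rw [hvarV]
    exact hG.mV2_sub_pos hlam hsig hne ht'
  · rw [correlation, hvarS, hvarV, hcov, e1, e2, e5, e6, e8]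
  · rw [correlation, hvarS, hvarV, hcov]
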